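/- **Setting.** A planar map is a connected planar (multi)graph $G$, finite or infinite, with a planar embedding given combinatorially, in which all vertices and all faces have finite degree. Let $(G,st)$ be a planar map with a distinguished oriented root edge $st$, $s\neq t$, such that $G$ minus the edge $st$ is connected. Let $G^*$ be the dual map, and let $s^*$ and $t^*$ be the faces to the right and to the left of $st$. Assume that simple random walk on $G$ and on $G^*$ is recurrent (automatic if $G$ is finite). For a vertex $v$ let $P(v)$ be the probability that simple random walk from $v$ visits $s$ before $t$ (the potential when all edges except $st$ are unit resistors, $s$ is held at potential $1$ and $t$ at potential $0$). Let $\lambda=\sum(1-P(v))$, the sum being over the edges $sv\neq st$ at $s$. For a face $f$ let $x(f)$ be $\lambda$ times the probability that simple random walk on $G^*$ from $f$ visits $s^*$ before $t^*$. For an edge $e=uv\ne st$ of $G$ with incident faces $f,g$, let $s_e$ be the closed axis-parallel square with side length $|P(u)-P(v)|$ (the current through $e$) and top left corner $(\min(x(f),x(g)),\max(P(u),P(v)))$; it is a single point if $e$ carries zero current. Let $S=S(G,st)$ be the closure of the union of the boundaries of the squares $s_e$, $e\neq st$. Assume that the squares $s_e$, $e\ne st$, have pairwise disjoint interiors and that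 $S$ is a *squaring of a rectangle*: $S$ is closed, every bounded component of $\mathbb{R}^2\setminus S$ is an open square, and the closure of the union of these bounded components is a compact rectangle. (By a theorem of Brooks, Smith, Stone and Tutte this always holds if $G$ is finite.) Assume finally that no edge $e\neq st$ of zero current has its degenerate square $s_e=\{p\}$ at a point $p$ common to four different squares $s_f$ of positive side length. **Definitions.** The *squares* of $S$ are the closures of all connected components of $\mathbb{R}^2\setminus S$, including the unbounded one. The *contacts graph* $R(S)$ has the squares of $S$ as its vertices, two different squares being adjacent if they intersect. The *derived map* $D(G)$ is obtained from $G$ by subdividing each edge $e$ once, by a new vertex $v_e$, and by adding a vertex inside each face, joined to the subdivision vertices of all edges incident to that face. The square $D(G)^2$ has the same vertices as $D(G)$, two different vertices being adjacent if their distance in $D(G)$ is at most $2$. **Lemma.** Under these assumptions, $R(S)$ is isomorphic to a subgraph of $D(G)^2$. -/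

import Mathlib

open scoped SimpleGraph

noncomputable section

/-- A map (graph embedded in an oriented surface), given by its rotation system.  `D` is the set of
darts (oriented edges), `σ` sends a dart to the next dart counterclockwise around its tail, and `α`
reverses a dart.  Loops and multiple edges are allowed. -/
structure CombMap (D : Type*) where
  σ : Equiv.Perm D
  α : Equiv.Perm D
  α_α : ∀ d, α (α d) = d
  α_ne : ∀ d, α d ≠ d

namespace CombMap

variable {D : Type*} (M : CombMap D)

/-- Vertices are the cycles of `σ`. -/
def Vertex : Type _ := Quotient (Equiv.Perm.SameCycle.setoid M.σ)

/-- Edges are the cycles of `α`. -/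
def Edge : Type _ := Quotient (Equiv.Perm.SameCycle.setoid M.α)

/-- The vertex from which a dart starts. -/
def tail (d : D) : M.Vertex := Quotient.mk (Equiv.Perm.SameCycle.setoid M.σ) d

/-- The vertex at which a dart ends. -/
def head (d : D) : M.Vertex := M.tail (M.α d)

/-- The edge underlying a dart. -/
def edge (d : D) : M.Edge := Quotient.mk (Equiv.Perm.SameCycle.setoid M.α) d

/-- The dual map.  It has the same darts: the dual of the dart `d` crosses `d` from the face on the
right of `d` to the face on its left.  So the darts with a given tail in the dual map are the darts
that have a given face on their right. -/
def dual : CombMap D where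
  σ := M.α * M.σ⁻¹
  α := M.α
  α_α := M.α_α
  α_ne := M.α_ne

/-- Faces are the vertices of the dual map. -/
abbrev Face : Type _ := M.dual.Vertex

/-- The face on the right of a dart. -/
abbrev rightFace (d : D) : M.Face := M.dual.tail d

/-- The face on the left of a dart. -/
abbrev leftFace (d : D) : M.Face := M.dual.head d

/-- All vertices and all faces have finite degree. -/
def LocallyFinite : Prop :=
  (∀ v : M.Vertex, {d | M.tail d = v}.Finite) ∧ (∀ f : M.Face, {d | M.rightFace d = f}.Finite)

/-- `b` is the first dart of `A` met after `a`, turning counterclockwise around the tail of `a`. -/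
def IsNextIn (A : Set D) (a b : D) : Prop :=
  ∃ k : ℕ, 0 < k ∧ (M.σ ^ k) a = b ∧ b ∈ A ∧ ∀ j : ℕ, 0 < j → j < k → (M.σ ^ j) a ∉ A

/-- The number of vertices of the submap with dart set `A`. -/
def numVertices (A : Set D) : ℕ := (M.tail '' A).ncard

/-- The number of connected components of the submap with dart set `A`. -/
def numComponents (A : Set D) : ℕ :=
  Nat.card (Quot fun a b : A => M.tail a = M.tail b ∨ (b : D) = M.α a)

/-- The number of faces of the submap with dart set `A`, counted separately for each of its
components (the boundary of a face is traced by following a dart and then turning to the next dart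
of `A` around its head). -/
def numFaces (A : Set D) : ℕ :=
  Nat.card (Quot fun a b : A => M.IsNextIn A (M.α a) b)

/-- A (finite or infinite) map is planar if all its finite submaps have genus `0`, that is, satisfy
Euler's formula `V - E + F = 2 C`, where `2 E` is the number of darts. -/
def IsPlanar : Prop :=
  ∀ A : Set D, A.Finite → (∀ d ∈ A, M.α d ∈ A) →
    2 * M.numVertices A + 2 * M.numFaces A = A.ncard + 4 * M.numComponents A

/-- The dart `d` belongs to the edge of the dart `r`. -/
def OnEdge (r d : D) : Prop := d = r ∨ d = M.α r

/-- `(M, r)` is an edge-rooted planar map: `M` is planar and locally finite, the root edge joins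
two distinct vertices, and `M` remains connected when the root edge is deleted. -/
structure IsEdgeRootedPlanar (r : D) : Prop where
  locallyFinite : M.LocallyFinite
  planar : M.IsPlanar
  root_ne : M.tail r ≠ M.head r
  connected : ∀ u v : M.Vertex,
    Relation.ReflTransGen (fun u v => ∃ d, ¬ M.OnEdge r d ∧ M.tail d = u ∧ M.head d = v) u v

/-! ### Simple random walk -/

open Classical in
/-- The probability that simple random walk started from `v` visits the set `a` within `n` steps,
and does so before visiting the set `b` (the points of `a` count as not being in `b`). -/
def hitWithin (a b : Set M.Vertex) : ℕ → M.Vertex → ℝ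
  | 0, v => if v ∈ a then 1 else 0
  | n + 1, v =>
      if v ∈ a then 1
      else if v ∈ b then 0
      else (∑ᶠ (d : D) (_ : M.tail d = v), hitWithin a b n (M.head d)) / {d | M.tail d = v}.ncard

/-- The probability that simple random walk started from `v` ever visits `a`, and does so before
visiting `b`. -/
def hitProb (a b : Set M.Vertex) (v : M.Vertex) : ℝ := ⨆ n, M.hitWithin a b n v

/-- Simple random walk started from any vertex `v` returns to `v` (at some positive time) with
probability `1`. -/
def IsRecurrent : Prop :=
  ∀ v : M.Vertex,
    (∑ᶠ (d : D) (_ : M.tail d = v), M.hitProb {v} ∅ (M.head d)) / {d | M.tail d = v}.ncard = 1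

/-! ### The squaring of an edge-rooted map -/

variable (r : D)

/-- The potential when a 1 volt supply is connected to the tail `s` of the root `r`, its head `t`
is grounded, and all edges but the root edge are unit resistors: the probability that simple random
walk visits `s` before `t`. -/
def potential (v : M.Vertex) : ℝ := M.hitProb {M.tail r} {M.head r} v

/-- The total current flowing out of the tail of the root, the root edge being cut. -/
def totalCurrent : ℝ :=
  ∑ᶠ (d : D) (_ : M.tail d = M.tail r ∧ d ≠ r), (1 - M.potential r (M.head d))

/-- The potential on the dual map, with the value `totalCurrent` at the face `s*` on the right of
the root, and `0` at the face `t*` on its left. -/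
def dualPotential (f : M.Face) : ℝ := M.totalCurrent r * M.dual.potential r f

/-- The absolute value of the current through the edge of `d`. -/
def side (d : D) : ℝ := |M.potential r (M.tail d) - M.potential r (M.head d)|

/-- The horizontal coordinate of the top left corner of the square of the edge of `d`. -/
def cornerX (d : D) : ℝ :=
  min (M.dualPotential r (M.rightFace d)) (M.dualPotential r (M.leftFace d))

/-- The vertical coordinate of the top left corner of the square of the edge of `d`. -/
def cornerY (d : D) : ℝ :=
  max (M.potential r (M.tail d)) (M.potential r (M.head d))

/-- The (closed, possibly degenerate) square of the edge of `d`. -/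
def square (d : D) : Set (ℝ × ℝ) :=
  Set.Icc (M.cornerX r d) (M.cornerX r d + M.side r d) ×ˢ
    Set.Icc (M.cornerY r d - M.side r d) (M.cornerY r d)

/-- The squaring `S(M, r)`: the union of the boundaries of the squares of the edges other than the
root edge.  The closure only matters when there are infinitely many edges; it adds the points of
accumulation of the squares. -/
def squaring : Set (ℝ × ℝ) :=
  closure (⋃ (d : D) (_ : ¬ M.OnEdge r d), frontier (M.square r d))

/-- The squares of different edges, other than the root edge, have disjoint interiors. -/
def SquaresDisjoint : Prop :=
  ∀ d d' : D, ¬ M.OnEdge r d → ¬ M.OnEdge r d' → M.edge d ≠ M.edge d' →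
    Disjoint (interior (M.square r d)) (interior (M.square r d'))

/-- If an edge other than the root edge carries no current, so that its square is a single point,
then this point does not lie in four different squares of positive side. -/
def NoDegenerateCross : Prop :=
  ∀ d : D, ¬ M.OnEdge r d → M.side r d = 0 →
    {Q | ∃ d' : D, ¬ M.OnEdge r d' ∧ 0 < M.side r d' ∧ Q = M.square r d' ∧
      (M.cornerX r d, M.cornerY r d) ∈ Q}.encard < 4

/-! ### The derived map -/

/-- The graph of the derived map.  Its vertices are the vertices of `M`, the subdivision vertices
(one for each edge of `M`) and the facial vertices (one for each face of `M`).  The subdivision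
vertex of an edge is joined to the ends of the edge and to the faces incident to the edge. -/
def derived : SimpleGraph (M.Vertex ⊕ M.Edge ⊕ M.Face) :=
  SimpleGraph.fromRel fun x y => ∃ d : D,
    x = Sum.inr (Sum.inl (M.edge d)) ∧
      (y = Sum.inl (M.tail d) ∨ y = Sum.inr (Sum.inr (M.rightFace d)))

end CombMap

/-- The square of a graph: two different vertices are adjacent when their distance is at most
two. -/
def graphSquare {V : Type*} (G : SimpleGraph V) : SimpleGraph V where
  Adj x y := x ≠ y ∧ ∃ p : G.Walk x y, p.length ≤ 2
  symm := ⟨fun _ _ h => ⟨h.1.symm, h.2.imp' SimpleGraph.Walk.reverse fun p hp => by simpa using hp⟩⟩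
  loopless := ⟨fun _ h => h.1 rfl⟩

/-! ### Squarings of rectangles and contacts graphs -/

/-- The connected components of the complement of a subset of the plane. -/
def complComponents (S : Set (ℝ × ℝ)) : Set (Set (ℝ × ℝ)) :=
  {C | ∃ p ∈ Sᶜ, C = connectedComponentIn Sᶜ p}

/-- `S` is a squaring of a rectangle: it is closed, the bounded components of its complement are
open squares, and the closure of their union is a compact rectangle (of positive width and
height). -/
def IsSquaringOfRectangle (S : Set (ℝ × ℝ)) : Prop :=
  IsClosed S ∧
  (∀ C ∈ complComponents S, Bornology.IsBounded C →
    ∃ x y l : ℝ, 0 < l ∧ C = Set.Ioo x (x + l) ×ˢ Set.Ioo y (y + l)) ∧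
  ∃ a b c d : ℝ, a < b ∧ c < d ∧
    closure (⋃₀ {C | C ∈ complComponents S ∧ Bornology.IsBounded C}) =
      Set.Icc a b ×ˢ Set.Icc c d

/-- The squares of `S`: the closures of the components of its complement, the unbounded one
included. -/
def squaresOf (S : Set (ℝ × ℝ)) : Set (Set (ℝ × ℝ)) := closure '' complComponents S

/-- The contacts graph of a collection of subsets of the plane: different sets are adjacent when
they intersect. -/
def contactsGraph (P : Set (Set (ℝ × ℝ))) : SimpleGraph P where
  Adj A B := A ≠ B ∧ ((A : Set (ℝ × ℝ)) ∩ (B : Set (ℝ × ℝ))).Nonempty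
  symm := ⟨fun _ _ h => ⟨h.1.symm, by rw [Set.inter_comm]; exact h.2⟩⟩
  loopless := ⟨fun _ h => h.1 rfl⟩

end

/-!
Turn the current flow into geometry.  Write `P` for the potential, `x` for the dual potential and
`λ` for the total current.

*Conjugacy.*  The current flow, closed up through the root edge, satisfies Kirchhoff's law at every
vertex, and by planarity it is the gradient of a function on the faces.  Recurrence of the dual map
identifies this function with `x`.  So crossing an edge from right to left changes `x` by as much
as following it decreases `P` (`IsElectrical.sub_eq`): the square of a dart `d` along which current
flows is `[x (right d), x (left d)] × [P (head d), P (tail d)]`.  Infinite maps are handled by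
Green's formula (`IsNetwork.green`): on a recurrent network the hitting probabilities within `n`
steps are finitely supported cutoff functions whose energy tends to `0`, so a flow of finite energy
loses nothing at infinity.  Planarity enters through Euler's formula only
(`exists_eq_sub_of_euler`): on a finite submap the gradients of functions on the vertices and of
functions on the faces are orthogonal, and Euler's formula says that together they span all flows.

*Touching squares.*  Going once around a vertex, `x` crosses each level upwards exactly if it
crosses it downwards, so a square below the level line of a vertex comes with a square of the same
vertex above it, and likewise for faces (`IsElectrical.exists_head_eq_tail` and its variants).  As
the squares have disjoint interiors, two squares that occupy neighbouring quadrants at a common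
point thus belong to edges with a common vertex or face.  If they occupy opposite quadrants and have
a corner there, four squares meet, and the dart that follows one of them around its tail either
lies on another one of them or carries no current; the latter would be a degenerate square in the
centre of a cross (`IsElectrical.eq_or_eq_of_four`).  A square at the boundary of the rectangle
shares a vertex or a face with the root edge, for otherwise there would be a square beyond the
boundary (`IsElectrical.share_root`).

*Components.*  The total area of the squares is the energy of the current, which is `λ`, the area of
the rectangle `[0, λ] × [0, 1]`; and degenerate squares are corners of proper ones
(`IsElectrical.exists_corner`).  Hence the components of the complement of the squaring are the
interiors of the proper squares and the exterior of the rectangle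
(`IsElectrical.eq_of_mem_complComponents`).  Sending squares to subdivision vertices, and the
exterior to the one of the root edge, embeds the contacts graph.
-/

namespace CombMap

variable {D : Type*} (M : CombMap D)

/-! ### Darts, vertices and faces -/

theorem tail_eq_tail_iff {d d' : D} : M.tail d = M.tail d' ↔ M.σ.SameCycle d d' :=
  Quotient.eq (r := Equiv.Perm.SameCycle.setoid M.σ)

theorem exists_tail_eq (v : M.Vertex) : ∃ d, M.tail d = v :=
  Quotient.exists_rep v

@[simp] theorem tail_σ (d : D) : M.tail (M.σ d) = M.tail d :=
  M.tail_eq_tail_iff.2 ((Equiv.Perm.sameCycle_apply_left).2 (Equiv.Perm.SameCycle.refl _ _))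

@[simp] theorem tail_α (d : D) : M.tail (M.α d) = M.head d := rfl

@[simp] theorem head_α (d : D) : M.head (M.α d) = M.tail d := by
  rw [head, M.α_α]

@[simp] theorem rightFace_α (d : D) : M.rightFace (M.α d) = M.leftFace d := rfl

@[simp] theorem leftFace_α (d : D) : M.leftFace (M.α d) = M.rightFace d :=
  M.dual.head_α d

/-- The face on the left of a dart is on the right of the next dart around its tail. -/
@[simp] theorem rightFace_σ (d : D) : M.rightFace (M.σ d) = M.leftFace d := by
  have h := M.dual.tail_σ (M.σ d)
  have e : M.dual.σ (M.σ d) = M.α d := by simp [dual]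
  rw [e] at h
  exact h.symm

theorem edge_eq_edge_iff {d d' : D} : M.edge d = M.edge d' ↔ d' = d ∨ d' = M.α d := by
  have h : M.edge d = M.edge d' ↔ M.α.SameCycle d d' :=
    Quotient.eq (r := Equiv.Perm.SameCycle.setoid M.α)
  rw [h]
  constructor
  · rintro ⟨i, hi⟩
    have h2 : M.α ^ (2 : ℤ) = 1 := by
      ext x
      rw [zpow_two]
      exact M.α_α x
    rcases Int.even_or_odd' i with ⟨k, rfl | rfl⟩
    · left
      rw [zpow_mul, h2] at hi
      simpa using hi.symm
    · right
      rw [zpow_add, zpow_mul, h2] at hi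
      simpa using hi.symm
  · rintro (rfl | rfl)
    · exact Equiv.Perm.SameCycle.refl _ _
    · exact ⟨1, by simp⟩

@[simp] theorem edge_α (d : D) : M.edge (M.α d) = M.edge d :=
  (M.edge_eq_edge_iff.2 (Or.inr rfl)).symm

theorem onEdge_α_iff {r d : D} : M.OnEdge r (M.α d) ↔ M.OnEdge r d := by
  unfold OnEdge
  rw [M.α.injective.eq_iff, or_comm]
  refine or_congr_right ⟨fun h => ?_, fun h => ?_⟩
  · rw [← h, M.α_α]
  · rw [h, M.α_α]

theorem tail_pow_σ (n : ℕ) (d : D) : M.tail ((M.σ ^ n) d) = M.tail d := by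
  induction n with
  | zero => simp
  | succ n ih => rw [pow_succ', Equiv.Perm.mul_apply, tail_σ, ih]

theorem exists_pow_apply_eq_self (hfin : ∀ v : M.Vertex, {d | M.tail d = v}.Finite) (d : D) :
    ∃ N : ℕ, 0 < N ∧ (M.σ ^ N) d = d := by
  obtain ⟨m, -, n, -, hmn, he⟩ := Set.infinite_univ.exists_lt_map_eq_of_mapsTo
    (f := fun n : ℕ => (M.σ ^ n) d) (t := {e | M.tail e = M.tail d})
    (fun n _ => M.tail_pow_σ n d) (hfin _)
  refine ⟨n - m, Nat.sub_pos_of_lt hmn, ?_⟩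
  have h1 : (M.σ ^ n) d = (M.σ ^ m) ((M.σ ^ (n - m)) d) := by
    rw [← Equiv.Perm.mul_apply, ← pow_add, Nat.add_sub_cancel' hmn.le]
  have h2 : (M.σ ^ m) d = (M.σ ^ n) d := he
  rw [h1] at h2
  exact ((M.σ ^ m).injective h2).symm

/-- If the orbits of `σ` are finite, a property that is inherited by the next dart around the tail
holds for all darts with a given tail as soon as it holds for one of them. -/
theorem of_tail_eq (hfin : ∀ v : M.Vertex, {d | M.tail d = v}.Finite) {p : D → Prop}
    (hp : ∀ d, p d → p (M.σ d)) {d d' : D} (h : M.tail d = M.tail d') (hd : p d) : p d' := by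
  have hpow : ∀ (n : ℕ) (e : D), p e → p ((M.σ ^ n) e) := by
    intro n
    induction n with
    | zero => intro e he; simpa using he
    | succ n ih =>
      intro e he
      rw [pow_succ', Equiv.Perm.mul_apply]
      exact hp _ (ih e he)
  obtain ⟨i, hi⟩ := M.tail_eq_tail_iff.1 h
  obtain ⟨N, hNpos, hN⟩ := M.exists_pow_apply_eq_self hfin d
  have hNpos' : (0 : ℤ) < N := by exact_mod_cast hNpos
  have hmod : (M.σ ^ (i % N)) d = d' := by
    have h3 : (M.σ ^ ((N : ℤ) * (i / N))) d = d := by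
      rw [zpow_mul, zpow_natCast]
      exact Function.IsFixedPt.perm_zpow (e := M.σ ^ N) hN _
    rw [← hi]
    conv_rhs => rw [← Int.emod_add_mul_ediv i N, zpow_add, Equiv.Perm.mul_apply, h3]
  obtain ⟨k, hk⟩ := Int.eq_ofNat_of_zero_le (Int.emod_nonneg i hNpos'.ne')
  rw [hk, zpow_natCast] at hmod
  rw [← hmod]
  exact hpow k d hd

/-! ### Flows on locally finite connected maps -/

/-- The map is connected and its vertices have finite degree. -/
structure IsNetwork : Prop where
  finite : ∀ v : M.Vertex, {d | M.tail d = v}.Finite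
  connected : ∀ u v : M.Vertex,
    Relation.ReflTransGen (fun u v => ∃ d, M.tail d = u ∧ M.head d = v) u v

variable {M}

/-- A set of darts that is closed under turning around the tail and under reversal contains all
darts, unless it is empty. -/
theorem IsNetwork.forall_of_exists (hN : M.IsNetwork) {p : D → Prop}
    (hσ : ∀ d, p d → p (M.σ d)) (hα : ∀ d, p d → p (M.α d)) {d : D} (hd : p d) (d' : D) :
    p d' := by
  have key : ∀ v, Relation.ReflTransGen (fun u v => ∃ d, M.tail d = u ∧ M.head d = v)
      (M.tail d) v → ∀ e, M.tail e = v → p e := by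
    intro v hv
    induction hv with
    | refl => exact fun e he => M.of_tail_eq hN.finite hσ he.symm hd
    | tail _ h2 ih =>
      obtain ⟨b, hb, hb'⟩ := h2
      intro e he
      exact M.of_tail_eq hN.finite hσ (d := M.α b) (hb'.trans he.symm) (hα b (ih b hb))
  exact key _ (hN.connected _ _) d' rfl

theorem IsNetwork.dual (hN : M.IsNetwork)
    (hfin : ∀ f : M.Face, {d | M.rightFace d = f}.Finite) : M.dual.IsNetwork where
  finite := hfin
  connected := by
    intro f f'
    obtain ⟨d, rfl⟩ := M.dual.exists_tail_eq f
    obtain ⟨d', rfl⟩ := M.dual.exists_tail_eq f'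
    have step : ∀ d, Relation.ReflTransGen
        (fun u v => ∃ d, M.dual.tail d = u ∧ M.dual.head d = v) (M.rightFace d) (M.leftFace d) :=
      fun d => Relation.ReflTransGen.single ⟨d, rfl, rfl⟩
    refine hN.forall_of_exists (p := fun e => Relation.ReflTransGen
      (fun u v => ∃ d, M.dual.tail d = u ∧ M.dual.head d = v) (M.rightFace d) (M.rightFace e))
      (fun e he => ?_) (fun e he => ?_) Relation.ReflTransGen.refl d'
    · rw [rightFace_σ]
      exact he.trans (step e)
    · rw [rightFace_α]
      exact he.trans (step e)

variable (M)

/-- The potential drop along a dart. -/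
def grad (g : M.Vertex → ℝ) (d : D) : ℝ := g (M.tail d) - g (M.head d)

/-- The net flow out of a vertex. -/
noncomputable def div (ω : D → ℝ) (v : M.Vertex) : ℝ := ∑ᶠ (d : D) (_ : M.tail d = v), ω d

theorem grad_α (g : M.Vertex → ℝ) (d : D) : M.grad g (M.α d) = -M.grad g d := by
  simp [grad]

variable {M}

theorem IsNetwork.div_eq_sum (hN : M.IsNetwork) (ω : D → ℝ) (v : M.Vertex) :
    M.div ω v = ∑ d ∈ (hN.finite v).toFinset, ω d :=
  finsum_mem_eq_finite_toFinset_sum ω (hN.finite v)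

theorem IsNetwork.div_add (hN : M.IsNetwork) (ω η : D → ℝ) (v : M.Vertex) :
    M.div (fun d => ω d + η d) v = M.div ω v + M.div η v := by
  simp only [hN.div_eq_sum, Finset.sum_add_distrib]

theorem IsNetwork.div_sub (hN : M.IsNetwork) (ω η : D → ℝ) (v : M.Vertex) :
    M.div (fun d => ω d - η d) v = M.div ω v - M.div η v := by
  simp only [hN.div_eq_sum, Finset.sum_sub_distrib]

theorem IsNetwork.div_const_mul (hN : M.IsNetwork) (c : ℝ) (ω : D → ℝ) (v : M.Vertex) :
    M.div (fun d => c * ω d) v = c * M.div ω v := by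
  simp only [hN.div_eq_sum, Finset.mul_sum]

theorem IsNetwork.div_const (hN : M.IsNetwork) (c : ℝ) (v : M.Vertex) :
    M.div (fun _ => c) v = {d | M.tail d = v}.ncard * c := by
  rw [hN.div_eq_sum, Finset.sum_const, nsmul_eq_mul, Set.ncard_eq_toFinset_card _ (hN.finite v)]

theorem IsNetwork.div_tail (hN : M.IsNetwork) (g : M.Vertex → ℝ) (v : M.Vertex) :
    M.div (fun d => g (M.tail d)) v = {d | M.tail d = v}.ncard * g v := by
  rw [← hN.div_const, hN.div_eq_sum, hN.div_eq_sum]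
  exact Finset.sum_congr rfl fun d hd => by
    rw [show M.tail d = v by simpa using hd]

theorem IsNetwork.div_grad (hN : M.IsNetwork) (g : M.Vertex → ℝ) (v : M.Vertex) :
    M.div (M.grad g) v =
      {d | M.tail d = v}.ncard * g v - M.div (fun d => g (M.head d)) v := by
  rw [← hN.div_tail, ← hN.div_sub]
  rfl

theorem IsNetwork.ncard_pos (hN : M.IsNetwork) (v : M.Vertex) :
    (0 : ℝ) < {d | M.tail d = v}.ncard := by
  obtain ⟨d, hd⟩ := M.exists_tail_eq v
  exact_mod_cast (Set.ncard_pos (hN.finite v)).2 ⟨d, hd⟩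

theorem IsNetwork.div_mono (hN : M.IsNetwork) {ω η : D → ℝ} {v : M.Vertex}
    (h : ∀ d, M.tail d = v → ω d ≤ η d) : M.div ω v ≤ M.div η v := by
  rw [hN.div_eq_sum, hN.div_eq_sum]
  exact Finset.sum_le_sum fun d hd => h d (by simpa using hd)

theorem IsNetwork.hasSum_tail (hN : M.IsNetwork) {g : M.Vertex → ℝ} {S : Finset M.Vertex}
    (hg : ∀ v ∉ S, g v = 0) (ω : D → ℝ) :
    HasSum (fun d => g (M.tail d) * ω d) (∑ v ∈ S, g v * M.div ω v) := by
  classical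
  let K : Finset D := S.biUnion fun v => (hN.finite v).toFinset
  have h : HasSum (fun d => g (M.tail d) * ω d) (∑ d ∈ K, g (M.tail d) * ω d) :=
      hasSum_sum_of_ne_finset_zero (by
    intro d hd
    have : M.tail d ∉ S := fun h => hd (Finset.mem_biUnion.2 ⟨_, h, by simp⟩)
    simp [hg _ this])
  convert h using 1
  rw [Finset.sum_biUnion]
  · refine Finset.sum_congr rfl fun v _ => ?_
    rw [hN.div_eq_sum, Finset.mul_sum]
    exact Finset.sum_congr rfl fun d hd => by
      rw [show M.tail d = v by simpa using hd]
  · intro u _ v _ huv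
    refine Finset.disjoint_left.2 fun d hd hd' => huv ?_
    rw [← show M.tail d = u by simpa using hd, show M.tail d = v by simpa using hd']

/-- Summation by parts for a finitely supported function. -/
theorem IsNetwork.hasSum_grad (hN : M.IsNetwork) {g : M.Vertex → ℝ} {S : Finset M.Vertex}
    (hg : ∀ v ∉ S, g v = 0) {ω : D → ℝ} (hω : ∀ d, ω (M.α d) = -ω d) :
    HasSum (fun d => M.grad g d * ω d) (2 * ∑ v ∈ S, g v * M.div ω v) := by
  have h := hN.hasSum_tail hg ω
  have h' := (Equiv.hasSum_iff M.α).2 h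
  convert h.add h' using 1
  · funext d
    simp only [grad, Function.comp, hω, tail_α]
    ring
  · ring

/-! ### Hitting probabilities -/

section Hit

variable (M) in
theorem hitWithin_zero (a b : Set M.Vertex) [∀ v, Decidable (v ∈ a)] (v : M.Vertex) :
    M.hitWithin a b 0 v = if v ∈ a then 1 else 0 := by
  rw [hitWithin]; congr

variable (M) in
theorem hitWithin_of_mem {a : Set M.Vertex} (b : Set M.Vertex) (n : ℕ) {v : M.Vertex}
    (hv : v ∈ a) : M.hitWithin a b n v = 1 := by
  cases n <;> simp [hitWithin, hv]

variable (M) in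
theorem hitWithin_of_mem_right {a b : Set M.Vertex} (n : ℕ) {v : M.Vertex} (hv : v ∉ a)
    (hb : v ∈ b) : M.hitWithin a b n v = 0 := by
  cases n <;> simp [hitWithin, hv, hb]

variable (M) in
theorem hitWithin_succ {a b : Set M.Vertex} (n : ℕ) {v : M.Vertex} (hv : v ∉ a)
    (hb : v ∉ b) : M.hitWithin a b (n + 1) v =
      M.div (fun d => M.hitWithin a b n (M.head d)) v / {d | M.tail d = v}.ncard := by
  simp [hitWithin, hv, hb, div]

variable (hN : M.IsNetwork) (a b : Set M.Vertex)
include hN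

theorem IsNetwork.hitWithin_nonneg (n : ℕ) (v : M.Vertex) : 0 ≤ M.hitWithin a b n v := by
  classical
  induction n generalizing v with
  | zero => rw [hitWithin_zero]; split_ifs <;> norm_num
  | succ n ih =>
    by_cases ha : v ∈ a
    · rw [M.hitWithin_of_mem b _ ha]; norm_num
    by_cases hb : v ∈ b
    · rw [M.hitWithin_of_mem_right _ ha hb]
    rw [M.hitWithin_succ n ha hb, hN.div_eq_sum]
    exact div_nonneg (Finset.sum_nonneg fun d _ => ih _) (Nat.cast_nonneg _)

theorem IsNetwork.hitWithin_le_one (n : ℕ) (v : M.Vertex) : M.hitWithin a b n v ≤ 1 := by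
  classical
  induction n generalizing v with
  | zero => rw [hitWithin_zero]; split_ifs <;> norm_num
  | succ n ih =>
    by_cases ha : v ∈ a
    · rw [M.hitWithin_of_mem b _ ha]
    by_cases hb : v ∈ b
    · rw [M.hitWithin_of_mem_right _ ha hb]; norm_num
    rw [M.hitWithin_succ n ha hb, div_le_one (hN.ncard_pos v)]
    refine (hN.div_mono fun d _ => ih (M.head d)).trans ?_
    rw [hN.div_const, mul_one]

theorem IsNetwork.hitWithin_le_succ (n : ℕ) (v : M.Vertex) :
    M.hitWithin a b n v ≤ M.hitWithin a b (n + 1) v := by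
  classical
  induction n generalizing v with
  | zero =>
    by_cases ha : v ∈ a
    · rw [M.hitWithin_of_mem b _ ha, M.hitWithin_of_mem b _ ha]
    · rw [hitWithin_zero, if_neg ha]
      exact hN.hitWithin_nonneg a b _ v
  | succ n ih =>
    by_cases ha : v ∈ a
    · rw [M.hitWithin_of_mem b _ ha, M.hitWithin_of_mem b _ ha]
    by_cases hb : v ∈ b
    · rw [M.hitWithin_of_mem_right _ ha hb, M.hitWithin_of_mem_right _ ha hb]
    rw [M.hitWithin_succ n ha hb, M.hitWithin_succ (n + 1) ha hb]
    exact div_le_div_of_nonneg_right (hN.div_mono fun d _ => ih (M.head d)) (Nat.cast_nonneg _)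

theorem IsNetwork.tendsto_hitWithin (v : M.Vertex) :
    Filter.Tendsto (fun n => M.hitWithin a b n v) Filter.atTop (nhds (M.hitProb a b v)) :=
  tendsto_atTop_ciSup (monotone_nat_of_le_succ fun n => hN.hitWithin_le_succ a b n v)
    ⟨1, by rintro _ ⟨n, rfl⟩; exact hN.hitWithin_le_one a b n v⟩

theorem IsNetwork.hitProb_nonneg (v : M.Vertex) : 0 ≤ M.hitProb a b v :=
  ge_of_tendsto' (hN.tendsto_hitWithin a b v) fun n => hN.hitWithin_nonneg a b n v

theorem IsNetwork.hitProb_le_one (v : M.Vertex) : M.hitProb a b v ≤ 1 :=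
  le_of_tendsto' (hN.tendsto_hitWithin a b v) fun n => hN.hitWithin_le_one a b n v

omit hN in
theorem hitProb_of_mem {v : M.Vertex} (hv : v ∈ a) : M.hitProb a b v = 1 := by
  simp [hitProb, M.hitWithin_of_mem b _ hv]

omit hN in
theorem hitProb_of_mem_right {v : M.Vertex} (hv : v ∉ a) (hb : v ∈ b) :
    M.hitProb a b v = 0 := by
  simp [hitProb, M.hitWithin_of_mem_right _ hv hb]

theorem IsNetwork.tendsto_div {ι : Type*} {l : Filter ι} {f : ι → D → ℝ} {g : D → ℝ}
    (h : ∀ d, Filter.Tendsto (fun n => f n d) l (nhds (g d))) (v : M.Vertex) :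
    Filter.Tendsto (fun n => M.div (f n) v) l (nhds (M.div g v)) := by
  simp only [hN.div_eq_sum]
  exact tendsto_finsetSum _ fun d _ => h d

theorem IsNetwork.hitProb_harmonic {v : M.Vertex} (ha : v ∉ a) (hb : v ∉ b) :
    M.div (M.grad (M.hitProb a b)) v = 0 := by
  have h1 := (hN.tendsto_hitWithin a b v).comp (Filter.tendsto_add_atTop_nat 1)
  have h2 := (hN.tendsto_div (fun d => hN.tendsto_hitWithin a b (M.head d)) v).div_const
    ({d | M.tail d = v}.ncard : ℝ)
  have h3 := tendsto_nhds_unique (h1.congr fun n => M.hitWithin_succ n ha hb) h2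
  rw [hN.div_grad, h3, mul_div_cancel₀ _ (hN.ncard_pos v).ne', sub_self]

theorem IsNetwork.finite_support_hitWithin (ha : a.Finite) (n : ℕ) :
    {v | M.hitWithin a b n v ≠ 0}.Finite := by
  classical
  induction n with
  | zero =>
    refine ha.subset fun v hv => ?_
    by_contra h
    exact hv (by rw [hitWithin_zero, if_neg h])
  | succ n ih =>
    refine (ha.union ((ih.biUnion fun v _ => hN.finite v).image M.head)).subset fun v hv => ?_
    by_cases hva : v ∈ a
    · exact Or.inl hva
    right
    by_cases hb : v ∈ b
    · exact absurd (M.hitWithin_of_mem_right _ hva hb) hv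
    rw [Set.mem_ofPred_eq, M.hitWithin_succ n hva hb, hN.div_eq_sum] at hv
    obtain ⟨d, hd, hd'⟩ := Finset.exists_ne_zero_of_sum_ne_zero (left_ne_zero_of_mul hv)
    refine ⟨M.α d, Set.mem_biUnion (x := M.head d) hd' rfl, ?_⟩
    rw [head_α]
    simpa using hd

/-- The Dirichlet energy of the probability of hitting a vertex `o` within `n` steps is bounded by
the flow out of `o`: everywhere else this function is at most the average over its neighbours. -/
theorem IsNetwork.energy_hitWithin (o : M.Vertex) (n : ℕ) :
    ∃ E, HasSum (fun d => M.grad (M.hitWithin {o} b n) d ^ 2) E ∧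
      E ≤ 2 * M.div (fun d => 1 - M.hitWithin {o} b n (M.head d)) o := by
  classical
  set u := M.hitWithin {o} b n with hu
  have hfin : {v | u v ≠ 0}.Finite := hN.finite_support_hitWithin {o} b (Set.finite_singleton o) n
  have huo : u o = 1 := M.hitWithin_of_mem b n rfl
  refine ⟨_, (hN.hasSum_grad (S := hfin.toFinset) (fun v hv => by simpa using hv)
    (M.grad_α u)).congr_fun (fun d => sq _), ?_⟩
  have hmem : o ∈ hfin.toFinset := by simp [huo]
  rw [← Finset.add_sum_erase _ _ hmem, huo, one_mul]
  have h1 : M.div (M.grad u) o = M.div (fun d => 1 - u (M.head d)) o := by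
    rw [hN.div_grad, hN.div_sub, hN.div_const, huo]
  have h2 : ∑ v ∈ hfin.toFinset.erase o, u v * M.div (M.grad u) v ≤ 0 := by
    refine Finset.sum_nonpos fun v hv => ?_
    have hvo : v ∉ ({o} : Set M.Vertex) := (Finset.mem_erase.1 hv).1
    by_cases hb : v ∈ b
    · rw [hu, M.hitWithin_of_mem_right n hvo hb, zero_mul]
    refine mul_nonpos_of_nonneg_of_nonpos (hN.hitWithin_nonneg _ _ _ _) ?_
    have h3 := hN.hitWithin_le_succ {o} b n v
    rw [M.hitWithin_succ n hvo hb, le_div_iff₀ (hN.ncard_pos v)] at h3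
    rw [hN.div_grad]
    linarith
  linarith

/-- Hitting probabilities of a vertex have finite Dirichlet energy. -/
theorem IsNetwork.summable_grad_hitProb (o : M.Vertex) :
    Summable fun d => M.grad (M.hitProb {o} b) d ^ 2 := by
  refine summable_of_sum_le (c := 2 * {d | M.tail d = o}.ncard) (fun d => sq_nonneg _) fun S => ?_
  have ht : Filter.Tendsto (fun n => ∑ d ∈ S, M.grad (M.hitWithin {o} b n) d ^ 2) Filter.atTop
      (nhds (∑ d ∈ S, M.grad (M.hitProb {o} b) d ^ 2)) :=
    tendsto_finsetSum _ fun d _ =>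
      ((hN.tendsto_hitWithin _ b _).sub (hN.tendsto_hitWithin _ b _)).pow 2
  refine le_of_tendsto' ht fun n => ?_
  obtain ⟨E, hE, hle⟩ := hN.energy_hitWithin b o n
  refine (sum_le_hasSum S (fun d _ => sq_nonneg _) hE).trans (hle.trans ?_)
  have := hN.div_mono (v := o) (ω := fun d => 1 - M.hitWithin {o} b n (M.head d))
    (η := fun _ => (1 : ℝ)) fun d _ => by linarith [hN.hitWithin_nonneg {o} b n (M.head d)]
  rw [hN.div_const, mul_one] at this
  linarith

omit b a in
/-- On a recurrent network every vertex is reached almost surely. -/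
theorem IsNetwork.hitProb_eq_one (hrec : M.IsRecurrent) (o v : M.Vertex) :
    M.hitProb {o} ∅ v = 1 := by
  -- a vertex whose average over the neighbours is `1` has only neighbours with the value `1`
  have nbr : ∀ w, M.div (fun d => M.hitProb {o} ∅ (M.head d)) w = {d | M.tail d = w}.ncard →
      ∀ d, M.tail d = w → M.hitProb {o} ∅ (M.head d) = 1 := by
    intro w hw d hd
    have h0 : M.div (fun d => 1 - M.hitProb {o} ∅ (M.head d)) w = 0 := by
      rw [hN.div_sub, hN.div_const, hw, mul_one, sub_self]
    rw [hN.div_eq_sum, Finset.sum_eq_zero_iff_of_nonneg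
      (fun d _ => sub_nonneg.2 (hN.hitProb_le_one _ _ _))] at h0
    linarith [h0 d (by simpa using hd)]
  induction hN.connected o v with
  | refl => exact hitProb_of_mem _ _ rfl
  | @tail w x _ h2 ih =>
    obtain ⟨d, hd, rfl⟩ := h2
    refine nbr w ?_ d hd
    by_cases hw : w = o
    · subst hw
      have := hrec w
      rw [div_eq_one_iff_eq (hN.ncard_pos w).ne'] at this
      exact this
    · have := hN.hitProb_harmonic {o} ∅ (v := w) hw (Set.notMem_empty _)
      rw [hN.div_grad, ih] at this
      linarith

omit b a in
/-- A recurrent network has finitely supported cutoff functions `φ n` with values in `[0, 1]` that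
tend to `1` pointwise and whose Dirichlet energy tends to `0`. -/
theorem IsNetwork.exists_cutoff (hrec : M.IsRecurrent) :
    ∃ φ : ℕ → M.Vertex → ℝ, (∀ n, {v | φ n v ≠ 0}.Finite) ∧ (∀ n v, 0 ≤ φ n v) ∧
      (∀ n v, φ n v ≤ 1) ∧ (∀ v, Filter.Tendsto (fun n => φ n v) Filter.atTop (nhds 1)) ∧
      (∀ n, Summable fun d => M.grad (φ n) d ^ 2) ∧
      Filter.Tendsto (fun n => ∑' d, M.grad (φ n) d ^ 2) Filter.atTop (nhds 0) := by
  rcases isEmpty_or_nonempty M.Vertex with hemp | ⟨⟨o⟩⟩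
  · have : IsEmpty D := ⟨fun d => hemp.elim (M.tail d)⟩
    exact ⟨fun _ _ => 0, fun n => Set.toFinite _, fun n v => hemp.elim v, fun n v => hemp.elim v,
      fun v => hemp.elim v, fun n => summable_empty, by simp⟩
  have hlim : ∀ v, Filter.Tendsto (fun n => M.hitWithin {o} ∅ n v) Filter.atTop (nhds 1) := by
    intro v
    have h := hN.tendsto_hitWithin {o} ∅ v
    rwa [hN.hitProb_eq_one hrec o v] at h
  refine ⟨M.hitWithin {o} ∅, hN.finite_support_hitWithin _ _ (Set.finite_singleton o),
    hN.hitWithin_nonneg _ _, hN.hitWithin_le_one _ _, hlim, fun n => ?_, ?_⟩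
  · obtain ⟨E, hE, -⟩ := hN.energy_hitWithin ∅ o n
    exact hE.summable
  · have h1 := (hN.tendsto_div
      (fun d => (tendsto_const_nhds (x := (1 : ℝ))).sub (hlim (M.head d))) o).const_mul 2
    rw [sub_self, hN.div_const, mul_zero, mul_zero] at h1
    refine squeeze_zero (fun n => tsum_nonneg fun d => sq_nonneg _) (fun n => ?_) h1
    obtain ⟨E, hE, hle⟩ := hN.energy_hitWithin ∅ o n
    rw [hE.tsum_eq]
    exact hle

end Hit

end CombMap

namespace CombMap

variable {D : Type*} {M : CombMap D}

/-- Green's formula.  On a recurrent network, no flow of finite energy escapes to infinity, so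
summation by parts holds for all bounded functions of finite energy. -/
theorem IsNetwork.green (hN : M.IsNetwork) (hrec : M.IsRecurrent) {ω : D → ℝ}
    (hω : ∀ d, ω (M.α d) = -ω d) (hω2 : Summable fun d => ω d ^ 2) {B : Finset M.Vertex}
    (hB : ∀ v ∉ B, M.div ω v = 0) {g : M.Vertex → ℝ} {C : ℝ} (hgC : ∀ v, |g v| ≤ C)
    (hg2 : Summable fun d => M.grad g d ^ 2) :
    HasSum (fun d => M.grad g d * ω d) (2 * ∑ v ∈ B, g v * M.div ω v) := by
  classical
  have hsum : ∀ {a b : D → ℝ}, (Summable fun d => a d ^ 2) → (Summable fun d => b d ^ 2) →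
      Summable fun d => |a d * b d| := by
    intro a b ha hb
    refine Summable.of_nonneg_of_le (fun d => abs_nonneg _) (fun d => ?_) (ha.add hb)
    rw [abs_mul]
    nlinarith [sq_nonneg (|a d| - |b d|), sq_abs (a d), sq_abs (b d), sq_nonneg (a d),
      sq_nonneg (b d)]
  obtain ⟨φ, hφfin, hφ0, hφ1, hφlim, hφ2, hφE⟩ := hN.exists_cutoff hrec
  have hgω : Summable fun d => M.grad g d * ω d := (hsum hg2 hω2).of_abs
  -- the gradient of `g * φ n` splits into a main term and an error term
  have hT1 : Filter.Tendsto (fun n => ∑' d, φ n (M.tail d) * (M.grad g d * ω d)) Filter.atTop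
      (nhds (∑' d, M.grad g d * ω d)) := by
    refine tendsto_tsum_of_dominated_convergence (bound := fun d => |M.grad g d * ω d|)
      (hsum hg2 hω2) (fun d => ?_) (Filter.Eventually.of_forall fun n d => ?_)
    · simpa using (hφlim (M.tail d)).mul_const (M.grad g d * ω d)
    · rw [norm_mul, Real.norm_eq_abs, Real.norm_eq_abs, abs_of_nonneg (hφ0 _ _)]
      exact mul_le_of_le_one_left (abs_nonneg _) (hφ1 _ _)
  have hC : 0 ≤ C ∨ IsEmpty D := by
    rcases isEmpty_or_nonempty D with h | ⟨⟨d⟩⟩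
    · exact Or.inr h
    · exact Or.inl ((abs_nonneg _).trans (hgC (M.tail d)))
  have herr : ∀ n, Summable fun d => g (M.head d) * (M.grad (φ n) d * ω d) := fun n =>
    Summable.of_norm_bounded ((hsum (hφ2 n) hω2).mul_left C) fun d => by
      rw [norm_mul]
      exact mul_le_mul_of_nonneg_right (hgC _) (abs_nonneg _)
  have hT2 : Filter.Tendsto (fun n => ∑' d, g (M.head d) * (M.grad (φ n) d * ω d)) Filter.atTop
      (nhds 0) := by
    rcases hC with hC | hD
    swap
    · simp
    have hlim : Filter.Tendsto (fun n => C * (Real.sqrt (∑' d, M.grad (φ n) d ^ 2) *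
        Real.sqrt (∑' d, ω d ^ 2))) Filter.atTop (nhds 0) := by
      have := ((Real.continuous_sqrt.tendsto 0).comp hφE).mul_const (Real.sqrt (∑' d, ω d ^ 2))
      simpa using this.const_mul C
    refine squeeze_zero_norm (fun n => ?_) hlim
    refine (norm_tsum_le_tsum_norm (herr n).norm).trans ?_
    have h1 : ∑' d, ‖g (M.head d) * (M.grad (φ n) d * ω d)‖ ≤
        ∑' d, C * |M.grad (φ n) d * ω d| := by
      refine Summable.tsum_le_tsum (fun d => ?_) (herr n).norm ((hsum (hφ2 n) hω2).mul_left C)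
      rw [norm_mul]
      exact mul_le_mul_of_nonneg_right (hgC _) (abs_nonneg _)
    refine h1.trans ?_
    rw [tsum_mul_left]
    refine mul_le_mul_of_nonneg_left ?_ hC
    have h2 := (Real.inner_le_Lp_mul_Lq_tsum_of_nonneg (f := fun d => |M.grad (φ n) d|)
      (g := fun d => |ω d|) Real.HolderConjugate.two_two (fun _ => abs_nonneg _)
      (fun _ => abs_nonneg _) (by simpa using hφ2 n) (by simpa using hω2))
    simpa [abs_mul, Real.sqrt_eq_rpow] using h2
  have hT : ∀ n, ∑' d, φ n (M.tail d) * (M.grad g d * ω d) +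
      ∑' d, g (M.head d) * (M.grad (φ n) d * ω d) =
      2 * ∑ v ∈ B, g v * φ n v * M.div ω v := by
    intro n
    have hs1 : Summable fun d => φ n (M.tail d) * (M.grad g d * ω d) :=
      Summable.of_norm_bounded (hsum hg2 hω2) fun d => by
        rw [norm_mul, Real.norm_eq_abs, Real.norm_eq_abs, abs_of_nonneg (hφ0 _ _)]
        exact mul_le_of_le_one_left (abs_nonneg _) (hφ1 _ _)
    rw [← hs1.tsum_add (herr n)]
    have h := hN.hasSum_grad (g := fun v => g v * φ n v) (S := (hφfin n).toFinset ∪ B)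
      (fun v hv => by
        have : φ n v = 0 := by
          by_contra h
          exact hv (Finset.mem_union_left _ (by simpa using h))
        simp [this]) hω
    rw [← Finset.sum_subset (s₁ := B) Finset.subset_union_right
      (fun v _ hv => by rw [hB v hv, mul_zero])] at h
    rw [← h.tsum_eq]
    refine tsum_congr fun d => ?_
    simp only [grad]
    ring
  have hlim2 : Filter.Tendsto (fun n => 2 * ∑ v ∈ B, g v * φ n v * M.div ω v) Filter.atTop
      (nhds (2 * ∑ v ∈ B, g v * M.div ω v)) := by
    refine (tendsto_finsetSum _ fun v _ => ?_).const_mul 2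
    simpa using ((hφlim v).const_mul (g v)).mul_const (M.div ω v)
  have h1 := hT1.add hT2
  rw [add_zero] at h1
  rw [← tendsto_nhds_unique (h1.congr hT) hlim2]
  exact hgω.hasSum

theorem IsNetwork.eq_of_grad_eq_zero (hN : M.IsNetwork) {h : M.Vertex → ℝ}
    (hh : ∀ d, M.grad h d = 0) (u v : M.Vertex) : h u = h v := by
  induction hN.connected u v with
  | refl => rfl
  | tail _ h2 ih =>
    obtain ⟨d, rfl, rfl⟩ := h2
    rw [ih]
    exact sub_eq_zero.1 (hh d)

/-- On a recurrent network, a function of finite energy that vanishes on a finite nonempty set and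
is harmonic off this set is zero.  The function may be unbounded, so Green's formula is applied to
its truncations. -/
theorem IsNetwork.eq_zero_of_harmonic (hN : M.IsNetwork) (hrec : M.IsRecurrent)
    {h : M.Vertex → ℝ} (hh2 : Summable fun d => M.grad h d ^ 2) {B : Finset M.Vertex}
    (hB : ∀ v ∉ B, M.div (M.grad h) v = 0) (hB0 : ∀ v ∈ B, h v = 0) (hne : B.Nonempty)
    (v : M.Vertex) : h v = 0 := by
  -- truncation at height `N` is monotone and does not increase differences
  have clamp : ∀ N a b : ℝ, (max (-N) (min a N) - max (-N) (min b N)) ^ 2 ≤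
      (max (-N) (min a N) - max (-N) (min b N)) * (a - b) := by
    intro N a b
    rcases max_cases (-N) (min a N) with h1 | h1 <;>
    rcases max_cases (-N) (min b N) with h2 | h2 <;>
    rcases min_cases a N with h3 | h3 <;> rcases min_cases b N with h4 | h4 <;>
    rw [h1.1, h2.1] <;> (try rw [h3.1]) <;> (try rw [h4.1]) <;> nlinarith
  have hgrad : ∀ d, M.grad h d = 0 := by
    intro d
    set N := max |h (M.tail d)| |h (M.head d)|
    have hN0 : 0 ≤ N := (abs_nonneg _).trans (le_max_left _ _)
    set g : M.Vertex → ℝ := fun v => max (-N) (min (h v) N) with hg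
    have hgh : ∀ d, M.grad g d ^ 2 ≤ M.grad g d * M.grad h d := fun d => clamp N _ _
    have hgN : ∀ v, |g v| ≤ N := fun v => abs_le.2
      ⟨le_max_left _ _, max_le (by linarith) (min_le_right _ _)⟩
    have hg2 : Summable fun d => M.grad g d ^ 2 := by
      refine Summable.of_nonneg_of_le (fun d => sq_nonneg _) (fun d => ?_) hh2
      nlinarith [hgh d, sq_nonneg (M.grad g d - M.grad h d)]
    have hsum := hN.green hrec (M.grad_α h) hh2 hB hgN hg2
    rw [Finset.sum_eq_zero (fun v hv => by
      simp [hg, hB0 v hv, hN0]), mul_zero] at hsum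
    rw [hasSum_zero_iff_of_nonneg fun d => (sq_nonneg _).trans (hgh d)] at hsum
    have h1 : M.grad g d = 0 := by
      have := hgh d
      have h0 : M.grad g d * M.grad h d = 0 := congrFun hsum d
      nlinarith [sq_nonneg (M.grad g d)]
    have hid : ∀ a : ℝ, |a| ≤ N → max (-N) (min a N) = a := fun a ha => by
      rw [min_eq_left (abs_le.1 ha).2, max_eq_right (abs_le.1 ha).1]
    simpa only [grad, hg, hid _ (le_max_left _ _), hid _ (le_max_right _ _)] using h1
  obtain ⟨w, hw⟩ := hne
  rw [hN.eq_of_grad_eq_zero hgrad v w, hB0 w hw]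

/-! ### Gradients -/

theorem IsNetwork.div_single (hN : M.IsNetwork) [DecidableEq D] [DecidableEq M.Vertex] (d : D)
    (v : M.Vertex) :
    M.div (Finsupp.single d (1 : ℝ)) v = if M.tail d = v then 1 else 0 := by
  rw [hN.div_eq_sum]
  simp [Finsupp.single_apply]

/-- A flow that is orthogonal to all finitely supported circulations is a gradient: its sum along a
path depends on the ends of the path only. -/
theorem IsNetwork.exists_eq_grad (hN : M.IsNetwork) {ω : D → ℝ} (hω : ∀ d, ω (M.α d) = -ω d)
    (H : ∀ c : D →₀ ℝ, (∀ d, c (M.α d) = -c d) → (∀ v, M.div c v = 0) →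
      Finsupp.linearCombination ℝ ω c = 0) :
    ∃ x : M.Vertex → ℝ, ω = M.grad x := by
  classical
  rcases isEmpty_or_nonempty D with hD | ⟨⟨d₀⟩⟩
  · exact ⟨0, Subsingleton.elim _ _⟩
  set o := M.tail d₀
  let unit : D → D →₀ ℝ := fun d => Finsupp.single d 1 - Finsupp.single (M.α d) 1
  have unit_α : ∀ d e, unit d (M.α e) = -unit d e := by
    intro d e
    have h1 : d = M.α e ↔ M.α d = e :=
      ⟨fun h => by rw [h, M.α_α], fun h => by rw [← h, M.α_α]⟩
    simp [unit, Finsupp.single_apply, h1]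
  have unit_div : ∀ d v, M.div (unit d) v =
      (if M.tail d = v then 1 else 0) - (if M.head d = v then 1 else 0) := by
    intro d v
    have : (unit d : D → ℝ) = fun e =>
        Finsupp.single d (1 : ℝ) e - Finsupp.single (M.α d) (1 : ℝ) e :=
      by ext; simp [unit]
    rw [this, hN.div_sub, hN.div_single, hN.div_single, tail_α]
  have unit_pair : ∀ d, Finsupp.linearCombination ℝ ω (unit d) = 2 * ω d := by
    intro d
    simp only [unit, map_sub, Finsupp.linearCombination_single, hω, smul_eq_mul]
    ring
  clear_value unit
  have div_add' : ∀ (c c' : D →₀ ℝ) v, M.div (c + c' : D →₀ ℝ) v = M.div c v + M.div c' v :=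
    fun c c' v => hN.div_add c c' v
  have div_sub' : ∀ (c c' : D →₀ ℝ) v, M.div (c - c' : D →₀ ℝ) v = M.div c v - M.div c' v :=
    fun c c' v => hN.div_sub c c' v
  have path : ∀ v, ∃ c : D →₀ ℝ, (∀ d, c (M.α d) = -c d) ∧
      ∀ w, M.div c w = (if o = w then 1 else 0) - (if v = w then 1 else 0) := by
    intro v
    induction hN.connected o v with
    | refl => exact ⟨0, by simp, fun w => by simp [hN.div_eq_sum]⟩
    | tail _ h2 ih =>
      obtain ⟨d, rfl, rfl⟩ := h2
      obtain ⟨c, hc, hc'⟩ := ih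
      refine ⟨c + unit d, fun e => ?_, fun w => ?_⟩
      · rw [Finsupp.add_apply, Finsupp.add_apply, hc, unit_α]
        ring
      · rw [div_add', hc', unit_div]
        ring
  choose c hc hc' using path
  refine ⟨fun v => -(Finsupp.linearCombination ℝ ω (c v)) / 2, ?_⟩
  funext d
  have h := H (c (M.tail d) + unit d - c (M.head d))
    (fun e => by
      rw [Finsupp.sub_apply, Finsupp.add_apply, hc, hc, unit_α, Finsupp.sub_apply,
        Finsupp.add_apply]
      ring)
    (fun v => by
      rw [div_sub', div_add', hc', hc', unit_div]
      ring)
  rw [map_sub, map_add, unit_pair] at h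
  simp only [grad]
  linarith

/-- A function whose gradient has finite support is bounded. -/
theorem IsNetwork.exists_bound_of_grad (hN : M.IsNetwork) {g : M.Vertex → ℝ}
    (hg : {d | M.grad g d ≠ 0}.Finite) : ∃ C, ∀ v, |g v| ≤ C := by
  rcases isEmpty_or_nonempty M.Vertex with h | ⟨⟨o⟩⟩
  · exact ⟨0, fun v => h.elim v⟩
  have hfin : (insert o (M.tail '' {d | M.grad g d ≠ 0})).Finite := (hg.image _).insert o
  obtain ⟨C, hC⟩ := (hfin.image fun v => |g v|).bddAbove
  refine ⟨C, fun v => ?_⟩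
  induction hN.connected o v with
  | refl => exact hC (Set.mem_image_of_mem _ (Set.mem_insert _ _))
  | tail _ h2 ih =>
    obtain ⟨d, rfl, rfl⟩ := h2
    by_cases hd : M.grad g d = 0
    · rwa [← sub_eq_zero.1 hd]
    · refine hC (Set.mem_image_of_mem _ (Set.mem_insert_of_mem _ ⟨M.α d, ?_, rfl⟩))
      simpa [grad_α] using hd

end CombMap

/-! ### Functions invariant under a relation -/

/-- The functions that take equal values at related points. -/
def invariantFunctions {ι : Type*} (R : ι → ι → Prop) : Submodule ℝ (ι → ℝ) where
  carrier := {ψ | ∀ a b, R a b → ψ a = ψ b}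
  add_mem' := fun hx hy a b h => by simp [hx a b h, hy a b h]
  zero_mem' := fun _ _ _ => rfl
  smul_mem' := fun c x hx a b h => by simp [hx a b h]

theorem finrank_invariantFunctions {ι : Type*} [Finite ι] (R : ι → ι → Prop) :
    Module.finrank ℝ (invariantFunctions R) = Nat.card (Quot R) := by
  have := Fintype.ofFinite (Quot R)
  have h : LinearMap.range (LinearMap.funLeft ℝ ℝ (Quot.mk R)) = invariantFunctions R := by
    ext ψ
    constructor
    · rintro ⟨φ, rfl⟩ a b hab
      simp [LinearMap.funLeft_apply, Quot.sound hab]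
    · intro hψ
      exact ⟨Quot.lift ψ hψ, by ext; simp [LinearMap.funLeft_apply]⟩
  rw [← h, LinearMap.finrank_range_of_inj
    (LinearMap.funLeft_injective_of_surjective _ _ _ Quot.mk_surjective),
    Module.finrank_fintype_fun_eq_card, Nat.card_eq_fintype_card]

theorem Submodule.finrank_le_finrank_map_add {E : Type*} [AddCommGroup E] [Module ℝ E]
    [FiniteDimensional ℝ E] (f : E →ₗ[ℝ] E) {W C : Submodule ℝ E}
    (h : ∀ x ∈ W, f x = 0 → x ∈ C) :
    Module.finrank ℝ W ≤ Module.finrank ℝ (W.map f) + Module.finrank ℝ C := by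
  have h1 := LinearMap.finrank_range_add_finrank_ker (f.domRestrict W)
  rw [LinearMap.range_domRestrict] at h1
  rw [← h1]
  refine Nat.add_le_add_left ?_ _
  rw [← Submodule.finrank_map_subtype_eq W (LinearMap.ker (f.domRestrict W))]
  refine Submodule.finrank_mono ?_
  rintro _ ⟨x, hx, rfl⟩
  exact h x x.2 hx

/-- The functions that change their sign under `τ`. -/
def antisymmetricFunctions {ι : Type*} (τ : ι → ι) : Submodule ℝ (ι → ℝ) where
  carrier := {c | ∀ a, c (τ a) = -c a}
  add_mem' := fun hx hy a => by simp [hx a, hy a]; ring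
  zero_mem' := fun _ => by simp
  smul_mem' := fun c x hx a => by simp [hx a]

/-- For a fixed-point-free involution, multiplication by an antisymmetric sign maps antisymmetric
functions to symmetric ones, so they make up at most half of all functions. -/
theorem two_mul_finrank_antisymmetricFunctions_le {ι : Type*} [Fintype ι] {τ : ι → ι}
    (hτ : ∀ a, τ (τ a) = a) (hne : ∀ a, τ a ≠ a) :
    2 * Module.finrank ℝ (antisymmetricFunctions τ) ≤ Fintype.card ι := by
  classical
  let e := Fintype.equivFin ι
  let s : ι → ℝ := fun a => if e a < e (τ a) then 1 else -1
  have hs : ∀ a, s (τ a) = -s a := by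
    intro a
    have : e a ≠ e (τ a) := fun h => hne a (e.injective h).symm
    simp only [s, hτ]
    rcases lt_or_gt_of_ne this with h | h
    · rw [if_neg h.not_gt, if_pos h]
    · rw [if_pos h, if_neg h.not_gt, neg_neg]
  have hs2 : ∀ a, s a * s a = 1 := by
    intro a
    simp only [s]
    split_ifs <;> norm_num
  let f : (ι → ℝ) →ₗ[ℝ] (ι → ℝ) := LinearMap.mulLeft ℝ s
  have hf : Function.Injective f := by
    intro x y hxy
    have : s * (s * x) = s * (s * y) := congrArg (s * ·) hxy
    rwa [← mul_assoc, ← mul_assoc, show s * s = 1 from funext hs2, one_mul, one_mul] at this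
  have h1 := (Submodule.equivMapOfInjective f hf (antisymmetricFunctions τ)).finrank_eq
  have hdisj : antisymmetricFunctions τ ⊓ (antisymmetricFunctions τ).map f = ⊥ := by
    rw [eq_bot_iff]
    rintro x ⟨hx, y, hy, rfl⟩
    refine (Submodule.mem_bot ℝ).2 (funext fun a => ?_)
    have h2 : s (τ a) * y (τ a) = -(s a * y a) := hx a
    rw [hs, hy a] at h2
    change s a * y a = 0
    linarith
  have h3 := Submodule.finrank_sup_add_finrank_inf_eq (antisymmetricFunctions τ)
    ((antisymmetricFunctions τ).map f)
  rw [hdisj, finrank_bot] at h3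
  have h4 := Submodule.finrank_le (antisymmetricFunctions τ ⊔ (antisymmetricFunctions τ).map f)
  rw [Module.finrank_fintype_fun_eq_card] at h4
  omega

namespace CombMap

variable {D : Type*} {M : CombMap D}

/-! ### Planarity -/

theorem exists_isNextIn (hfin : ∀ v : M.Vertex, {d | M.tail d = v}.Finite) {A : Set D} {a : D}
    (ha : a ∈ A) : ∃ b, M.IsNextIn A a b := by
  classical
  have h : ∃ k, 0 < k ∧ (M.σ ^ k) a ∈ A := by
    obtain ⟨N, hN, hN'⟩ := M.exists_pow_apply_eq_self hfin a
    exact ⟨N, hN, by rwa [hN']⟩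
  exact ⟨_, Nat.find h, (Nat.find_spec h).1, rfl, (Nat.find_spec h).2,
    fun j hj hlt hA => Nat.find_min h hlt ⟨hj, hA⟩⟩

theorem IsNextIn.tail_eq {A : Set D} {a b : D} (h : M.IsNextIn A a b) : M.tail b = M.tail a := by
  obtain ⟨k, -, rfl, -⟩ := h
  exact M.tail_pow_σ k a

theorem IsNextIn.eq_of_eq {A : Set D} {a a' b : D} (ha : a ∈ A) (ha' : a' ∈ A)
    (h : M.IsNextIn A a b) (h' : M.IsNextIn A a' b) : a = a' := by
  have key : ∀ {a a' : D} {k k' : ℕ}, a ∈ A → 0 < k → (M.σ ^ k) a = (M.σ ^ k') a' →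
      (∀ j : ℕ, 0 < j → j < k' → (M.σ ^ j) a' ∉ A) → ¬ k < k' := by
    intro a a' k k' ha hk he hmin hlt
    refine hmin (k' - k) (by omega) (by omega) ?_
    have : (M.σ ^ k') a' = (M.σ ^ k) ((M.σ ^ (k' - k)) a') := by
      rw [← Equiv.Perm.mul_apply, ← pow_add, Nat.add_sub_cancel' hlt.le]
    rw [this] at he
    rwa [← (M.σ ^ k).injective he]
  obtain ⟨k, hk, hb, -, hmin⟩ := h
  obtain ⟨k', hk', hb', -, hmin'⟩ := h'
  have h1 := key ha hk (hb.trans hb'.symm) hmin'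
  have h2 := key ha' hk' (hb'.trans hb.symm) hmin
  obtain rfl : k = k' := by omega
  exact (M.σ ^ k).injective (hb.trans hb'.symm)

/-- The algebraic content of Euler's formula: on a finite planar map, a flow whose sum along every
face vanishes is a gradient.  Gradients on the map and gradients on its dual are orthogonal, and by
Euler's formula their dimensions add up to the number of edges. -/
theorem exists_eq_sub_of_euler (hfin : ∀ v : M.Vertex, {d | M.tail d = v}.Finite) {A : Set D}
    (hα : ∀ d ∈ A, M.α d ∈ A)
    (heuler : 2 * M.numVertices A + 2 * M.numFaces A = A.ncard + 4 * M.numComponents A)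
    [Fintype A] {c : D → ℝ} (hc : ∀ d, c (M.α d) = -c d)
    (hface : ∀ χ : A → ℝ, (∀ a b : A, M.IsNextIn A (M.α a) b → χ a = χ b) →
      ∑ a : A, c a * χ a = 0) :
    ∃ γ : M.Vertex → ℝ, ∀ a ∈ A, c a = M.grad γ a := by
  classical
  let τ : A ≃ A := ⟨fun a => ⟨M.α a, hα a a.2⟩, fun a => ⟨M.α a, hα a a.2⟩,
    fun a => Subtype.ext (M.α_α a), fun a => Subtype.ext (M.α_α a)⟩
  have hτ : ∀ a, τ (τ a) = a := fun a => Subtype.ext (M.α_α a)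
  have hex : ∀ a : A, ∃ b : A, M.IsNextIn A a b := fun a => by
    obtain ⟨b, hb⟩ := M.exists_isNextIn hfin a.2
    exact ⟨⟨b, by obtain ⟨-, -, -, h, -⟩ := hb; exact h⟩, hb⟩
  choose ν hν using hex
  have hνbij : Function.Bijective ν := Finite.injective_iff_bijective.1 fun a a' h =>
    Subtype.ext ((hν a).eq_of_eq a.2 a'.2 (h ▸ hν a'))
  let νe := Equiv.ofBijective ν hνbij
  let V : Submodule ℝ (A → ℝ) := invariantFunctions fun a b => M.tail a = M.tail b
  let F : Submodule ℝ (A → ℝ) := invariantFunctions fun a b => M.IsNextIn A (M.α a) b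
  let C : Submodule ℝ (A → ℝ) :=
    invariantFunctions fun a b => M.tail a = M.tail b ∨ (b : D) = M.α a
  have hVcard : Module.finrank ℝ V = M.numVertices A := by
    rw [finrank_invariantFunctions, numVertices, ← Nat.card_coe_set_eq]
    refine Nat.card_eq_of_bijective
      (Quot.lift (fun a => ⟨M.tail a, a, a.2, rfl⟩) fun a b h => Subtype.ext h) ⟨?_, ?_⟩
    · rintro ⟨a⟩ ⟨b⟩ h
      exact Quot.sound (Subtype.ext_iff.1 h)
    · rintro ⟨_, a, ha, rfl⟩
      exact ⟨Quot.mk _ ⟨a, ha⟩, rfl⟩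
  have hFcard : Module.finrank ℝ F = M.numFaces A := finrank_invariantFunctions _
  have hCcard : Module.finrank ℝ C = M.numComponents A := finrank_invariantFunctions _
  let δ : (A → ℝ) →ₗ[ℝ] (A → ℝ) := LinearMap.id - LinearMap.funLeft ℝ ℝ τ
  have hδ : ∀ ψ a, δ ψ a = ψ a - ψ (τ a) := fun ψ a => rfl
  have hVC : ∀ ψ ∈ V, δ ψ = 0 → ψ ∈ C := by
    rintro ψ hψ h0 a b (h | h)
    · exact hψ a b h
    · have := congrFun h0 a
      rw [hδ, show τ a = b from Subtype.ext h.symm] at this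
      exact sub_eq_zero.1 this
  have hFC : ∀ ψ ∈ F, δ ψ = 0 → ψ ∈ C := by
    intro ψ hψ h0
    have hsym : ∀ a, ψ (τ a) = ψ a := fun a => (sub_eq_zero.1 (congrFun h0 a)).symm
    have hnext : ∀ a b : A, M.IsNextIn A a b → ψ a = ψ b := by
      intro a b hab
      rw [← hsym a]
      refine hψ (τ a) b ?_
      change M.IsNextIn A (M.α (M.α a)) b
      rwa [M.α_α]
    rintro a b (h | h)
    · -- the darts of `A` at a vertex are met one after the other, turning around the vertex
      let q : D → Prop := fun e => ∃ a' : A, ψ a' = ψ a ∧ ∃ k : ℕ, (M.σ ^ k) (a' : D) = e ∧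
        ∀ j : ℕ, 0 < j → j ≤ k → (M.σ ^ j) (a' : D) ∉ A
      have hq : q b := by
        refine M.of_tail_eq hfin (p := q) ?_ h ⟨a, rfl, 0, rfl, fun j h1 h2 => by omega⟩
        rintro e ⟨a', ha', k, rfl, hk⟩
        by_cases he : M.σ ((M.σ ^ k) (a' : D)) ∈ A
        · refine ⟨⟨_, he⟩, ?_, 0, rfl, fun j h1 h2 => by omega⟩
          rw [← ha']
          refine (hnext _ _ ⟨k + 1, k.succ_pos, ?_, he, fun j h1 h2 => hk j h1 (by omega)⟩).symm
          rw [pow_succ', Equiv.Perm.mul_apply]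
        · refine ⟨a', ha', k + 1, by rw [pow_succ', Equiv.Perm.mul_apply], fun j h1 h2 => ?_⟩
          rcases Nat.lt_or_ge k j with hj | hj
          · obtain rfl : j = k + 1 := by omega
            rwa [pow_succ', Equiv.Perm.mul_apply]
          · exact hk j h1 hj
      obtain ⟨a', ha', k, hk, hmin⟩ := hq
      rcases Nat.eq_zero_or_pos k with rfl | hpos
      · rw [← ha', show a' = b from Subtype.ext hk]
      · exact absurd (hk ▸ b.2) (hmin k hpos le_rfl)
    · rw [← show τ a = b from Subtype.ext h.symm, hsym]
  have hVdim := Submodule.finrank_le_finrank_map_add δ hVC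
  have hFdim := Submodule.finrank_le_finrank_map_add δ hFC
  have hanti : ∀ W : Submodule ℝ (A → ℝ), W.map δ ≤ antisymmetricFunctions τ := by
    rintro W _ ⟨ψ, -, rfl⟩ a
    rw [hδ, hδ, hτ]
    ring
  have hpair : ∀ c' ∈ antisymmetricFunctions τ, ∀ χ : A → ℝ,
      ∑ a, c' a * δ χ a = 2 * ∑ a, c' a * χ a := by
    intro c' hc' χ
    have h1 : ∑ a, c' a * χ (τ a) = -∑ a, c' a * χ a := by
      rw [← Equiv.sum_comp τ fun a => c' a * χ a, ← Finset.sum_neg_distrib]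
      exact Finset.sum_congr rfl fun a _ => by rw [hc' a]; ring
    simp only [hδ, mul_sub, Finset.sum_sub_distrib, h1]
    ring
  have horth : ∀ ψ ∈ V, ∀ χ ∈ F, ∑ a, δ ψ a * δ χ a = 0 := by
    intro ψ hψ χ hχ
    rw [hpair _ (hanti V ⟨ψ, hψ, rfl⟩)]
    have h1 : ∑ a, ψ (τ a) * χ a = ∑ a, ψ a * χ a := by
      rw [← Equiv.sum_comp (τ.trans νe) fun a => ψ a * χ a]
      refine Finset.sum_congr rfl fun a _ => ?_
      rw [hψ (τ a) ((τ.trans νe) a) (hν (τ a)).tail_eq.symm, hχ a ((τ.trans νe) a) (hν (τ a))]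
    simp only [hδ, sub_mul, Finset.sum_sub_distrib, h1, sub_self, mul_zero]
  have hzero : ∀ f : A → ℝ, ∑ a, f a * f a = 0 → f = 0 := fun f hf => funext fun a =>
    mul_self_eq_zero.1 ((Finset.sum_eq_zero_iff_of_nonneg fun a _ => mul_self_nonneg _).1 hf a
      (Finset.mem_univ a))
  have hinf : V.map δ ⊓ F.map δ = ⊥ := by
    rw [eq_bot_iff]
    rintro _ ⟨⟨ψ, hψ, rfl⟩, χ, hχ, he⟩
    refine (Submodule.mem_bot ℝ).2 (hzero _ ?_)
    have := horth ψ hψ χ hχ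
    rwa [he] at this
  have hsup : V.map δ ⊔ F.map δ = antisymmetricFunctions τ := by
    refine Submodule.eq_of_le_of_finrank_le (sup_le (hanti V) (hanti F)) ?_
    have h1 := Submodule.finrank_sup_add_finrank_inf_eq (V.map δ) (F.map δ)
    rw [hinf, finrank_bot] at h1
    have h2 := two_mul_finrank_antisymmetricFunctions_le hτ
      (fun a h => M.α_ne a (Subtype.ext_iff.1 h))
    rw [← Nat.card_eq_fintype_card, Nat.card_coe_set_eq] at h2
    omega
  have hcA : (fun a : A => c a) ∈ antisymmetricFunctions τ := fun a => hc a
  have hcA' := hcA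
  rw [← hsup, Submodule.mem_sup] at hcA'
  obtain ⟨_, ⟨ψ, hψ, rfl⟩, _, ⟨χ, hχ, rfl⟩, hsum⟩ := hcA'
  have h0 : δ χ = 0 := by
    refine hzero _ ?_
    have h1 := hpair _ hcA χ
    rw [hface χ hχ, mul_zero] at h1
    have h2 : ∀ a : A, c a = δ ψ a + δ χ a := fun a => (congrFun hsum a).symm
    simpa [h2, add_mul, Finset.sum_add_distrib, horth ψ hψ χ hχ] using h1
  rw [h0, add_zero] at hsum
  refine ⟨fun v => if h : ∃ a : A, M.tail a = v then ψ h.choose else 0, fun a ha => ?_⟩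
  have hval : ∀ a : A, (if h : ∃ a' : A, M.tail a' = M.tail a then ψ h.choose else 0) = ψ a := by
    intro a
    have h : ∃ a' : A, M.tail a' = M.tail a := ⟨a, rfl⟩
    rw [dif_pos h]
    exact hψ _ _ h.choose_spec
  have h1 := congrFun hsum ⟨a, ha⟩
  rw [hδ, ← hval, ← hval] at h1
  exact h1.symm

/-- On a planar map, a finitely supported flow whose sum along every face vanishes is a
gradient. -/
theorem IsNetwork.exists_eq_grad_of_isPlanar (hN : M.IsNetwork) (hN' : M.dual.IsNetwork)
    (hplanar : M.IsPlanar) {c : D →₀ ℝ} (hc : ∀ d, c (M.α d) = -c d)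
    (hface : ∀ f, M.dual.div c f = 0) : ∃ g : M.Vertex → ℝ, ⇑c = M.grad g := by
  classical
  refine hN.exists_eq_grad hc fun c' hc' hdiv => ?_
  let A₀ : Set D := (⋃ d ∈ c.support, {e | M.rightFace e = M.rightFace d}) ∪ c'.support
  have hA₀ : A₀.Finite :=
    (c.support.finite_toSet.biUnion fun d _ => hN'.finite _).union c'.support.finite_toSet
  let A : Set D := A₀ ∪ M.α '' A₀
  have hA : A.Finite := hA₀.union (hA₀.image _)
  have hα : ∀ d ∈ A, M.α d ∈ A := by
    rintro d (hd | ⟨e, he, rfl⟩)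
    · exact Or.inr ⟨d, hd, rfl⟩
    · rw [M.α_α]
      exact Or.inl he
  have : Fintype A := hA.fintype
  have hAface : ∀ d, c d ≠ 0 → ∀ e, M.rightFace e = M.rightFace d → e ∈ A := fun d hd e he =>
    Or.inl (Or.inl (Set.mem_biUnion (x := d) (by simpa using hd) he))
  have hsumA : ∀ (f : D → ℝ), (∀ d ∉ A, f d = 0) → HasSum f (∑ a : A, f a) := by
    intro f hf
    have h : HasSum f (∑ a ∈ A.toFinset, f a) := hasSum_sum_of_ne_finset_zero fun d hd =>
      hf d (by simpa using hd)
    rwa [Finset.sum_subtype A.toFinset (p := (· ∈ A)) (by simp) f] at h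
  obtain ⟨γ, hγ⟩ := M.exists_eq_sub_of_euler hN.finite hα (hplanar A hA hα) hc (by
    intro χ hχ
    -- a face that meets the support of `c` lies in `A`, so it is also a face of `A`
    have hconst : ∀ (d : D) (hd : c d ≠ 0) (e : D) (he : e ∈ A),
        M.rightFace d = M.rightFace e → χ ⟨d, hAface d hd d rfl⟩ = χ ⟨e, he⟩ := by
      intro d hd e he hde
      have := M.dual.of_tail_eq hN'.finite (p := fun e => M.rightFace e = M.rightFace d ∧
        ∀ h : e ∈ A, χ ⟨d, hAface d hd d rfl⟩ = χ ⟨e, h⟩) ?_ hde ⟨rfl, fun _ => rfl⟩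
      · exact this.2 he
      · rintro e ⟨he1, he2⟩
        have he3 : M.rightFace (M.dual.σ e) = M.rightFace d := (M.dual.tail_σ e).trans he1
        have heA := hAface d hd e he1
        refine ⟨he3, fun h => ?_⟩
        rw [he2 heA]
        refine (hχ ⟨M.dual.σ e, h⟩ ⟨e, heA⟩
          ⟨1, one_pos, ?_, heA, fun j h1 h2 => by omega⟩).symm
        rw [pow_one]
        change M.σ (M.α (M.α (M.σ⁻¹ e))) = e
        rw [M.α_α, show M.σ (M.σ⁻¹ e) = e from M.σ.apply_symm_apply e]
    let ξ : M.Face → ℝ := fun f =>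
      if h : ∃ d, ∃ hd : c d ≠ 0, M.rightFace d = f then
        χ ⟨h.choose, hAface _ h.choose_spec.choose _ rfl⟩ else 0
    have hξ : ∀ a : A, ξ (M.rightFace a) * c a = c a * χ a := by
      intro a
      by_cases ha : c a = 0
      · simp [ha]
      · have h : ∃ d, ∃ hd : c d ≠ 0, M.rightFace d = M.rightFace a := ⟨a, ha, rfl⟩
        rw [mul_comm]
        congr 1
        simp only [ξ, dif_pos h]
        exact hconst _ h.choose_spec.choose _ a.2 h.choose_spec.choose_spec
    have h1 := hN'.hasSum_tail (g := ξ) (S := c.support.image M.rightFace) (by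
      intro f hf
      refine dif_neg ?_
      rintro ⟨d, hd, rfl⟩
      exact hf (Finset.mem_image_of_mem _ (by simpa using hd))) c
    have h2 := hsumA (fun d => ξ (M.rightFace d) * c d) (fun d hd => by
      have : c d = 0 := by
        by_contra h
        exact hd (hAface d h d rfl)
      simp [this])
    have h3 := h1.unique h2
    simp only [hface, mul_zero, Finset.sum_const_zero, hξ] at h3
    exact h3.symm)
  have hc'A : ∀ d ∉ A, c' d = 0 := fun d hd => by
    by_contra h
    exact hd (Or.inl (Or.inr (by simpa using h)))
  let γ' : M.Vertex → ℝ := fun v => if v ∈ M.tail '' A then γ v else 0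
  have hγ' : ∀ a ∈ A, c a = M.grad γ' a := by
    intro a ha
    rw [hγ a ha, grad, grad]
    simp only [γ']
    rw [if_pos ⟨a, ha, rfl⟩, if_pos ⟨M.α a, hα a ha, rfl⟩]
  have h1 := hN.hasSum_grad (g := γ') (S := (hA.image M.tail).toFinset)
    (fun v hv => if_neg (by simpa using hv)) hc'
  simp only [hdiv, mul_zero, Finset.sum_const_zero] at h1
  have h2 := hsumA (fun d => M.grad γ' d * c' d) (fun d hd => by simp [hc'A d hd])
  have h3 := hsumA (fun d => c d * c' d) (fun d hd => by simp [hc'A d hd])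
  have h4 : ∑ a : A, c a * c' a = ∑ a : A, M.grad γ' a * c' a :=
    Finset.sum_congr rfl fun a _ => by rw [hγ' a a.2]
  rw [h4, h2.unique h1] at h3
  have h5 : HasSum (fun d => c d * c' d) (Finsupp.linearCombination ℝ c c') := by
    rw [Finsupp.linearCombination_apply, Finsupp.sum]
    simp only [smul_eq_mul, mul_comm (c' _)]
    exact hasSum_sum_of_ne_finset_zero fun d hd => by
      simp [show c' d = 0 by simpa using hd]
  exact h5.unique h3

end CombMap

namespace CombMap

variable {D : Type*} {M : CombMap D}

/-! ### The dual potential is conjugate to the potential -/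

theorem IsNetwork.div_comp_σ (hN : M.IsNetwork) (ω : D → ℝ) (v : M.Vertex) :
    M.div (fun d => ω (M.σ d)) v = M.div ω v := by
  rw [hN.div_eq_sum, hN.div_eq_sum]
  exact Finset.sum_equiv M.σ (by simp) fun _ _ => rfl

theorem head_dual_σ (d : D) : M.head (M.dual.σ d) = M.tail d := by
  change M.head (M.α (M.σ⁻¹ d)) = M.tail d
  rw [head_α, ← tail_σ, show M.σ (M.σ⁻¹ d) = d from M.σ.apply_symm_apply d]

/-- Gradients have no circulation along faces. -/
theorem IsNetwork.dual_div_grad (hN' : M.dual.IsNetwork) (g : M.Vertex → ℝ) (f : M.Face) :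
    M.dual.div (M.grad g) f = 0 := by
  have h1 := hN'.div_comp_σ (fun d => g (M.head d)) f
  simp only [head_dual_σ] at h1
  have h2 := hN'.div_sub (fun d => g (M.tail d)) (fun d => g (M.head d)) f
  rw [h1, sub_self] at h2
  exact h2

theorem IsEdgeRootedPlanar.isNetwork {r : D} (hM : M.IsEdgeRootedPlanar r) : M.IsNetwork where
  finite := hM.locallyFinite.1
  connected u v := Relation.ReflTransGen.mono (fun _ _ ⟨d, _, h⟩ => ⟨d, h⟩) _ _ (hM.connected u v)

variable (M)

open Classical in
/-- The current flow, closed up by the current that the battery sends through the root edge. -/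
noncomputable def flow (r d : D) : ℝ :=
  if d = r then -M.totalCurrent r else if d = M.α r then M.totalCurrent r
  else M.grad (M.potential r) d

/-- What the squaring inherits from the theory of electrical networks: the potential and the dual
potential are conjugate, that is, they have the same difference along an edge and across it, and
the total area of the squares is the area of the rectangle `[0, λ] × [0, 1]`, where `λ` is the total
current (in `hasSum` every square is counted for both darts of its edge). -/
structure IsElectrical (r : D) : Prop where
  network : M.IsNetwork
  dual_network : M.dual.IsNetwork
  pos : 0 < M.totalCurrent r
  potential_tail : M.potential r (M.tail r) = 1
  potential_head : M.potential r (M.head r) = 0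
  nonneg : ∀ v, 0 ≤ M.potential r v
  le_one : ∀ v, M.potential r v ≤ 1
  dual_right : M.dualPotential r (M.rightFace r) = M.totalCurrent r
  dual_left : M.dualPotential r (M.leftFace r) = 0
  dual_nonneg : ∀ f, 0 ≤ M.dualPotential r f
  dual_le : ∀ f, M.dualPotential r f ≤ M.totalCurrent r
  sub_eq : ∀ d, ¬ M.OnEdge r d →
    M.dualPotential r (M.leftFace d) - M.dualPotential r (M.rightFace d) =
      M.potential r (M.tail d) - M.potential r (M.head d)
  hasSum : HasSum ({d | ¬ M.OnEdge r d}.indicator fun d => M.side r d ^ 2) (2 * M.totalCurrent r)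

variable {M}

theorem IsEdgeRootedPlanar.isElectrical {r : D} (hM : M.IsEdgeRootedPlanar r)
    (hrec : M.IsRecurrent) (hrec' : M.dual.IsRecurrent) : M.IsElectrical r := by
  classical
  have hN := hM.isNetwork
  have hN' := hN.dual hM.locallyFinite.2
  set P := M.potential r with hP
  set l := M.totalCurrent r with hl
  set ω := M.flow r with hω
  have hPs : P (M.tail r) = 1 := hitProb_of_mem _ _ rfl
  have hPt : P (M.head r) = 0 := hitProb_of_mem_right _ _ (fun h => hM.root_ne h.symm) rfl
  have hP2 : Summable fun d => M.grad P d ^ 2 := hN.summable_grad_hitProb _ _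
  have hr : ω r = -l := by simp [hω, flow, ← hl]
  have hαr : ω (M.α r) = l := by simp [hω, flow, M.α_ne, ← hl]
  have hω_of : ∀ d, ¬ M.OnEdge r d → ω d = M.grad P d := by
    intro d hd
    simp only [OnEdge, not_or] at hd
    simp [hω, flow, hd.1, hd.2, hP]
  have hωα : ∀ d, ω (M.α d) = -ω d := by
    intro d
    by_cases hd : M.OnEdge r d
    · rcases hd with rfl | rfl
      · rw [hr, hαr, neg_neg]
      · rw [M.α_α, hr, hαr]
    · rw [hω_of d hd, hω_of _ (fun h => hd (M.onEdge_α_iff.1 h)), grad_α]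
  have hω2 : Summable fun d => ω d ^ 2 := by
    refine hP2.congr_cofinite ?_
    refine ((Set.toFinite {r, M.α r}).subset fun d hd => ?_)
    by_contra h
    exact hd (congrArg (· ^ 2) (hω_of d fun h' => h (by simpa [OnEdge] using h')).symm)
  -- Kirchhoff's law: at the head of the root it holds because no current escapes to infinity
  have hdiv_of : ∀ v, v ≠ M.head r → M.div ω v = 0 := by
    intro v hvt
    rw [hN.div_eq_sum]
    by_cases hvs : v = M.tail r
    · subst hvs
      have hmem : r ∈ (hN.finite (M.tail r)).toFinset := by simp
      rw [← Finset.add_sum_erase _ _ hmem, hr]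
      have h1 : l = ∑ d ∈ (hN.finite (M.tail r)).toFinset.erase r,
          (1 - M.potential r (M.head d)) := by
        rw [hl, totalCurrent, ← finsum_mem_coe_finset]
        refine finsum_congr fun d => finsum_congr_Prop ?_ fun _ => rfl
        simp [and_comm]
      rw [h1, neg_add_eq_zero]
      refine Finset.sum_congr rfl fun d hd => ?_
      simp only [Finset.mem_erase, Set.Finite.mem_toFinset, Set.mem_ofPred_eq] at hd
      rw [hω_of d, grad, hd.2, hPs]
      rintro (h | rfl)
      · exact hd.1 h
      · exact hM.root_ne hd.2.symm
    · rw [← hN.hitProb_harmonic {M.tail r} {M.head r} hvs hvt, hN.div_eq_sum]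
      refine Finset.sum_congr rfl fun d hd => ?_
      have hd' : M.tail d = v := by simpa using hd
      refine hω_of d ?_
      rintro (rfl | rfl)
      · exact hvs hd'.symm
      · exact hvt hd'.symm
  have hdiv : ∀ v, M.div ω v = 0 := by
    intro v
    by_cases hv : v = M.head r
    · have h := hN.green hrec hωα hω2 (B := {M.head r})
        (fun v hv => hdiv_of v (by simpa using hv)) (g := fun _ => 1) (C := 1) (by simp)
        (by simp [grad])
      have h0 : HasSum (fun d => M.grad (fun _ => (1 : ℝ)) d * ω d) 0 := by
        simp [grad]
      have := h.unique h0
      rw [hv]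
      simpa using this
    · exact hdiv_of v hv
  have henergy : HasSum ({d | ¬ M.OnEdge r d}.indicator fun d => M.side r d ^ 2) (2 * l) := by
    have h := hN.green hrec hωα hω2 (B := ∅) (fun v _ => hdiv v) (g := P) (C := 1)
      (fun v =>
        (abs_of_nonneg (hN.hitProb_nonneg _ _ v)).trans_le (hN.hitProb_le_one _ _ v)) hP2
    have h' := (h.add (hasSum_ite_eq r l)).add (hasSum_ite_eq (M.α r) l)
    convert h' using 1
    · funext d
      by_cases hd : M.OnEdge r d
      · rw [Set.indicator_of_notMem (by simpa using hd)]
        rcases hd with rfl | rfl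
        · rw [hr, if_pos rfl, if_neg (M.α_ne _).symm, grad, hPs, hPt]
          ring
        · rw [hαr, if_pos rfl, if_neg (M.α_ne r), grad, head_α, tail_α, hPs, hPt]
          ring
      · rw [Set.indicator_of_mem (by simpa using hd), hω_of d hd, side, sq_abs]
        simp only [OnEdge, not_or] at hd
        rw [if_neg hd.1, if_neg hd.2, grad]
        ring
    · simp
      ring
  have hpos : 0 < l := by
    have h0 : ∀ d, 0 ≤ ({d | ¬ M.OnEdge r d}.indicator fun d => M.side r d ^ 2) d :=
      fun d => Set.indicator_nonneg (fun _ _ => sq_nonneg _) d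
    have hl0 : 0 ≤ l := by linarith [henergy.nonneg h0]
    refine hl0.lt_of_ne fun h => ?_
    rw [← h, mul_zero, hasSum_zero_iff_of_nonneg h0] at henergy
    have hconst : ∀ u v, Relation.ReflTransGen
        (fun u v => ∃ d, ¬ M.OnEdge r d ∧ M.tail d = u ∧ M.head d = v) u v → P u = P v := by
      intro u v huv
      induction huv with
      | refl => rfl
      | tail _ h2 ih =>
        obtain ⟨d, hd, rfl, rfl⟩ := h2
        have h3 := congrFun henergy d
        rw [Set.indicator_of_mem (by simpa using hd), side] at h3
        rw [ih]
        simpa [sub_eq_zero] using h3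
    have := hconst _ _ (hM.connected (M.tail r) (M.head r))
    rw [hPs, hPt] at this
    exact one_ne_zero this
  -- by planarity the flow is the gradient of a function on the faces
  obtain ⟨x, hx⟩ := hN'.exists_eq_grad (ω := fun d => -ω d) (fun d => by
      change -ω (M.α d) = - -ω d
      rw [hωα]) (by
    intro c hc hcdiv
    obtain ⟨g, hg⟩ := hN.exists_eq_grad_of_isPlanar hN' hM.planar hc hcdiv
    have hgfin : {d | M.grad g d ≠ 0}.Finite := by
      rw [← hg]
      exact c.hasFiniteSupport
    obtain ⟨C, hC⟩ := hN.exists_bound_of_grad hgfin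
    have h := hN.green hrec hωα hω2 (B := ∅) (fun v _ => hdiv v) hC
      (summable_of_hasFiniteSupport (hgfin.subset fun d hd h => hd (by simp [h])))
    rw [Finset.sum_empty, mul_zero, ← hg] at h
    have h2 : HasSum (fun d => c d * -ω d) (Finsupp.linearCombination ℝ (fun d => -ω d) c) := by
      rw [Finsupp.linearCombination_apply, Finsupp.sum]
      exact hasSum_sum_of_ne_finset_zero fun d hd => by
        simp [show c d = 0 by simpa using hd]
    refine h2.unique ?_
    simpa using h.neg)
  have hx' : ∀ d, x (M.leftFace d) - x (M.rightFace d) = ω d := by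
    intro d
    have : -ω d = x (M.rightFace d) - x (M.leftFace d) := congrFun hx d
    linarith
  have hlr : M.rightFace r ≠ M.leftFace r := by
    intro h
    have := hx' r
    rw [hr, h, sub_self] at this
    linarith
  -- it is the dual potential, because finite energy harmonic functions are unique
  have hxq : ∀ f, M.dualPotential r f = x f - x (M.leftFace r) := by
    intro f
    set q := M.dual.potential r with hq
    have hqs : q (M.rightFace r) = 1 := hitProb_of_mem _ _ rfl
    have hqt : q (M.leftFace r) = 0 := hitProb_of_mem_right _ _ (fun h => hlr h.symm) rfl
    have hq2 : Summable fun d => M.dual.grad q d ^ 2 := hN'.summable_grad_hitProb _ _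
    set h : M.Face → ℝ := fun f => x f - x (M.leftFace r) - l * q f with hh
    have hgrad : M.dual.grad h = fun d => -ω d - l * M.dual.grad q d := by
      funext d
      rw [congrFun hx d]
      simp only [grad, hh]
      ring
    have := hN'.eq_zero_of_harmonic hrec' (h := h) (B := {M.rightFace r, M.leftFace r})
      (by
        rw [hgrad]
        refine Summable.of_nonneg_of_le (fun d => sq_nonneg _) (fun d => ?_)
          ((hω2.mul_left 2).add (hq2.mul_left (2 * l ^ 2)))
        nlinarith [sq_nonneg (ω d - l * M.dual.grad q d)])
      (by
        intro f hf
        simp only [Finset.mem_insert, Finset.mem_singleton, not_or] at hf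
        rw [hgrad, hN'.div_sub, hN'.div_const_mul,
          show M.dual.div (M.dual.grad q) f = 0 from hN'.hitProb_harmonic _ _ hf.1 hf.2, mul_zero,
          sub_zero]
        have h1 := hN'.div_const_mul (-1) (M.grad P) f
        rw [hN'.dual_div_grad, mul_zero] at h1
        rw [← h1, hN'.div_eq_sum, hN'.div_eq_sum]
        refine Finset.sum_congr rfl fun d hd => ?_
        have hd' : M.rightFace d = f := by simpa using hd
        rw [hω_of d, neg_one_mul]
        rintro (rfl | rfl)
        · exact hf.1 hd'.symm
        · exact hf.2 hd'.symm)
      (by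
        intro f hf
        simp only [Finset.mem_insert, Finset.mem_singleton] at hf
        rcases hf with rfl | rfl
        · have := hx' r
          rw [hr] at this
          simp only [hh, hqs]
          linarith
        · simp only [hh, hqt]
          ring)
      ⟨_, Finset.mem_insert_self _ _⟩ f
    simp only [hh] at this
    rw [dualPotential, ← hl, ← hq]
    linarith
  exact {
    network := hN
    dual_network := hN'
    pos := hpos
    potential_tail := hPs
    potential_head := hPt
    nonneg := hN.hitProb_nonneg _ _
    le_one := hN.hitProb_le_one _ _
    dual_right := by
      have := hx' r
      rw [hr] at this
      rw [hxq]
      linarith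
    dual_left := by rw [hxq, sub_self]
    dual_nonneg := fun f => mul_nonneg hpos.le (hN'.hitProb_nonneg _ _ f)
    dual_le := fun f => mul_le_of_le_one_right hpos.le (hN'.hitProb_le_one _ _ f)
    sub_eq := fun d hd => by
      rw [hxq, hxq, sub_sub_sub_cancel_right, hx', hω_of d hd]
      rfl
    hasSum := henergy }

end CombMap

namespace CombMap

variable {D : Type*} {M : CombMap D} {r : D}

/-! ### Crossing a level around a vertex or a face -/

/-- A property that is acquired on the passage through some dart at a vertex is lost on the passage
through another one. -/
theorem IsNetwork.exists_crossing (hN : M.IsNetwork) {before after : D → Prop}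
    (h : ∀ d, before (M.σ d) ↔ after d) {d : D} (hb : ¬ before d) (ha : after d) :
    ∃ d', M.tail d' = M.tail d ∧ before d' ∧ ¬ after d' := by
  by_contra! hcon
  have key := M.of_tail_eq hN.finite (p := fun e => M.tail e = M.tail d ∧ after e)
    (fun e he => ⟨(M.tail_σ e).trans he.1,
      hcon _ ((M.tail_σ e).trans he.1) ((h e).2 he.2)⟩)
    (d := d) (d' := M.σ⁻¹ d) ?_ ⟨rfl, ha⟩
  · have := (h _).2 key.2
    rw [show M.σ (M.σ⁻¹ d) = d from M.σ.apply_symm_apply d] at this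
    exact hb this
  · rw [← M.tail_σ (M.σ⁻¹ d), show M.σ (M.σ⁻¹ d) = d from M.σ.apply_symm_apply d]

variable (M r)

/-- The dart `d` is not on the root edge and carries a positive current, from its tail to its
head. -/
def IsDown (d : D) : Prop :=
  ¬ M.OnEdge r d ∧ M.potential r (M.head d) < M.potential r (M.tail d)

/-- The horizontal side of the square of the downward dart `d` crosses into the upper set `U`.  For
`U = Ici x` and `U = Ioi x` this says that the side has points close to `x` on the left, and on the
right, respectively. -/
def CrossX (U : Set ℝ) (d : D) : Prop :=
  M.dualPotential r (M.rightFace d) ∉ U ∧ M.dualPotential r (M.leftFace d) ∈ U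

/-- The vertical side of the square of the downward dart `d` crosses into the upper set `V`.  For
`V = Ici y` and `V = Ioi y` this says that the side has points close to `y` below it, and above it,
respectively. -/
def CrossY (V : Set ℝ) (d : D) : Prop :=
  M.potential r (M.head d) ∉ V ∧ M.potential r (M.tail d) ∈ V

variable {M r}

theorem side_α (d : D) : M.side r (M.α d) = M.side r d := by
  simp only [side, head_α, tail_α, abs_sub_comm]

theorem square_α (d : D) : M.square r (M.α d) = M.square r d := by
  have h1 : M.cornerX r (M.α d) = M.cornerX r d := by
    simp only [cornerX, leftFace_α, rightFace_α, min_comm]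
  have h2 : M.cornerY r (M.α d) = M.cornerY r d := by
    simp only [cornerY, head_α, tail_α, max_comm]
  simp only [square, h1, h2, side_α]

theorem IsDown.side_pos {d : D} (hd : M.IsDown r d) : 0 < M.side r d :=
  abs_pos.2 (sub_pos.2 hd.2).ne'

theorem isDown_or_isDown_α {d : D} (hd : ¬ M.OnEdge r d) (hs : 0 < M.side r d) :
    M.IsDown r d ∨ M.IsDown r (M.α d) := by
  rcases lt_or_gt_of_ne (sub_ne_zero.1 (abs_pos.1 hs)) with h | h
  · exact Or.inr ⟨fun h' => hd (M.onEdge_α_iff.1 h'), by rwa [head_α, tail_α]⟩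
  · exact Or.inl ⟨hd, h⟩

theorem IsDown.left_sub (hE : M.IsElectrical r) {d : D} (hd : M.IsDown r d) :
    M.dualPotential r (M.rightFace d) < M.dualPotential r (M.leftFace d) := by
  have := hE.sub_eq d hd.1
  linarith [hd.2]

theorem IsDown.square_eq (hE : M.IsElectrical r) {d : D} (hd : M.IsDown r d) :
    M.square r d =
      Set.Icc (M.dualPotential r (M.rightFace d)) (M.dualPotential r (M.leftFace d)) ×ˢ
        Set.Icc (M.potential r (M.head d)) (M.potential r (M.tail d)) := by
  have h1 := hE.sub_eq d hd.1
  have h2 : M.side r d = M.potential r (M.tail d) - M.potential r (M.head d) :=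
    abs_of_pos (sub_pos.2 hd.2)
  rw [square, cornerX, cornerY, h2, min_eq_left (hd.left_sub hE).le, max_eq_left hd.2.le,
    sub_sub_cancel, ← h1, add_sub_cancel]

theorem IsDown.interior_square (hE : M.IsElectrical r) {d : D} (hd : M.IsDown r d) :
    interior (M.square r d) =
      Set.Ioo (M.dualPotential r (M.rightFace d)) (M.dualPotential r (M.leftFace d)) ×ˢ
        Set.Ioo (M.potential r (M.head d)) (M.potential r (M.tail d)) := by
  rw [hd.square_eq hE, interior_prod_eq, interior_Icc, interior_Icc]

theorem IsDown.eq_of_edge_eq {d d' : D} (hd : M.IsDown r d) (hd' : M.IsDown r d')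
    (h : M.edge d = M.edge d') : d = d' := by
  rcases M.edge_eq_edge_iff.1 h with h | h
  · exact h.symm
  · have h1 := hd.2
    have h2 := hd'.2
    rw [h, head_α, tail_α] at h2
    exact absurd h1 h2.not_gt

theorem IsDown.eq_of_not_disjoint (hdisj : M.SquaresDisjoint r) {d d' : D} (hd : M.IsDown r d)
    (hd' : M.IsDown r d')
    (h : ¬ Disjoint (interior (M.square r d)) (interior (M.square r d'))) : d = d' := by
  by_contra hne
  exact h (hdisj d d' hd.1 hd'.1 fun he => hne (hd.eq_of_edge_eq hd' he))

/-- At most one square meets a given quadrant at a given point. -/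
theorem IsDown.eq_of_cross (hE : M.IsElectrical r) (hdisj : M.SquaresDisjoint r) {d d' : D}
    (hd : M.IsDown r d) (hd' : M.IsDown r d') {U V : Set ℝ} (hU : IsUpperSet U)
    (hV : IsUpperSet V) (h1 : M.CrossX r U d) (h1' : M.CrossX r U d') (h2 : M.CrossY r V d)
    (h2' : M.CrossY r V d') : d = d' := by
  have key : ∀ {W : Set ℝ}, IsUpperSet W → ∀ {a b : ℝ}, a ∉ W → b ∈ W → a < b := by
    intro W hW a b ha hb
    by_contra! h
    exact ha (hW h hb)
  refine hd.eq_of_not_disjoint hdisj hd' (Set.not_disjoint_iff.2 ?_)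
  rw [hd.interior_square hE, hd'.interior_square hE]
  obtain ⟨x, hx1, hx2⟩ := exists_between (max_lt (lt_min (key hU h1.1 h1.2) (key hU h1.1 h1'.2))
    (lt_min (key hU h1'.1 h1.2) (key hU h1'.1 h1'.2)))
  obtain ⟨y, hy1, hy2⟩ := exists_between (max_lt (lt_min (key hV h2.1 h2.2) (key hV h2.1 h2'.2))
    (lt_min (key hV h2'.1 h2.2) (key hV h2'.1 h2'.2)))
  rw [max_lt_iff] at hx1 hy1
  rw [lt_min_iff] at hx2 hy2
  exact ⟨(x, y), ⟨⟨hx1.1, hx2.1⟩, hy1.1, hy2.1⟩, ⟨hx1.2, hx2.2⟩, hy1.2, hy2.2⟩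

/-! ### Squares on both sides of a vertex or a face -/

section Transfer

variable (hE : M.IsElectrical r)
include hE

theorem IsElectrical.not_onEdge_of_potential {v : M.Vertex} (h0 : 0 < M.potential r v)
    (h1 : M.potential r v < 1) : ∀ e, M.tail e = v → ¬ M.OnEdge r e := by
  rintro e rfl (rfl | rfl)
  · exact h1.ne hE.potential_tail
  · exact h0.ne' hE.potential_head

theorem IsElectrical.not_onEdge_of_dualPotential {f : M.Face} (h0 : 0 < M.dualPotential r f)
    (h1 : M.dualPotential r f < M.totalCurrent r) :
    ∀ e, M.rightFace e = f → ¬ M.OnEdge r e := by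
  rintro e rfl (rfl | rfl)
  · exact h1.ne hE.dual_right
  · exact h0.ne' hE.dual_left

/-- Below a square of a current entering a vertex there is, up to the horizontal position, a square
of a current leaving it. -/
theorem IsElectrical.exists_tail_eq_head {d : D} {U : Set ℝ} (hU : IsUpperSet U)
    (hc : M.CrossX r U d)
    (hroot : ∀ e, M.tail e = M.head d → ¬ M.OnEdge r e) :
    ∃ d', M.IsDown r d' ∧ M.tail d' = M.head d ∧ M.CrossX r U d' := by
  obtain ⟨e, he, hb, ha⟩ := hE.network.exists_crossing
    (before := fun e => M.dualPotential r (M.rightFace e) ∉ U)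
    (after := fun e => M.dualPotential r (M.leftFace e) ∉ U) (d := M.α d)
    (fun e => by rw [rightFace_σ]) (by simpa using hc.2) (by simpa using hc.1)
  rw [not_not] at ha
  rw [tail_α] at he
  have hroot := hroot e he
  have hlt : M.dualPotential r (M.rightFace e) < M.dualPotential r (M.leftFace e) := by
    by_contra! h
    exact hb (hU h ha)
  exact ⟨e, ⟨hroot, by linarith [hE.sub_eq e hroot]⟩, he, hb, ha⟩

/-- Above a square of a current leaving a vertex there is, up to the horizontal position, a square
of a current entering it. -/
theorem IsElectrical.exists_head_eq_tail {d : D} {U : Set ℝ} (hU : IsUpperSet U)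
    (hc : M.CrossX r U d)
    (hroot : ∀ e, M.tail e = M.tail d → ¬ M.OnEdge r e) :
    ∃ d', M.IsDown r d' ∧ M.head d' = M.tail d ∧ M.CrossX r U d' := by
  obtain ⟨e, he, hb, ha⟩ := hE.network.exists_crossing
    (before := fun e => M.dualPotential r (M.rightFace e) ∈ U)
    (after := fun e => M.dualPotential r (M.leftFace e) ∈ U) (d := d)
    (fun e => by rw [rightFace_σ]) hc.1 hc.2
  have hroot := hroot e he
  have hlt : M.dualPotential r (M.leftFace e) < M.dualPotential r (M.rightFace e) := by
    by_contra! h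
    exact ha (hU h hb)
  refine ⟨M.α e, ⟨fun h => hroot (M.onEdge_α_iff.1 h), ?_⟩, by rw [head_α, he], ?_, ?_⟩
  · rw [head_α, tail_α]
    linarith [hE.sub_eq e hroot]
  · rwa [rightFace_α]
  · rwa [leftFace_α]

/-- On the other side of a face there is, up to the vertical position, another square. -/
theorem IsElectrical.exists_leftFace_eq_rightFace {d : D} {V : Set ℝ} (hV : IsUpperSet V)
    (hc : M.CrossY r V d)
    (hroot : ∀ e, M.rightFace e = M.rightFace d → ¬ M.OnEdge r e) :
    ∃ d', M.IsDown r d' ∧ M.leftFace d' = M.rightFace d ∧ M.CrossY r V d' := by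
  obtain ⟨e, he, hb, ha⟩ := hE.dual_network.exists_crossing
    (before := fun e => M.potential r (M.head e) ∈ V)
    (after := fun e => M.potential r (M.tail e) ∈ V) (d := d)
    (fun e => by rw [head_dual_σ]) hc.1 hc.2
  have hroot := hroot e he
  have hlt : M.potential r (M.tail e) < M.potential r (M.head e) := by
    by_contra! h
    exact ha (hV h hb)
  refine ⟨M.α e, ⟨fun h => hroot (M.onEdge_α_iff.1 h), ?_⟩, by rw [leftFace_α]; exact he, ?_, ?_⟩
  · rwa [head_α, tail_α]
  · rwa [head_α]
  · rwa [tail_α]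

theorem IsElectrical.exists_rightFace_eq_leftFace {d : D} {V : Set ℝ} (hV : IsUpperSet V)
    (hc : M.CrossY r V d)
    (hroot : ∀ e, M.rightFace e = M.leftFace d → ¬ M.OnEdge r e) :
    ∃ d', M.IsDown r d' ∧ M.rightFace d' = M.leftFace d ∧ M.CrossY r V d' := by
  obtain ⟨e, he, hb, ha⟩ := hE.dual_network.exists_crossing
    (before := fun e => M.potential r (M.head e) ∉ V)
    (after := fun e => M.potential r (M.tail e) ∉ V) (d := M.α d)
    (fun e => by rw [head_dual_σ]) (by simpa using hc.2) (by simpa using hc.1)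
  rw [not_not] at ha
  have hroot := hroot e he
  have hlt : M.potential r (M.head e) < M.potential r (M.tail e) := by
    by_contra! h
    exact hb (hV h ha)
  exact ⟨e, ⟨hroot, hlt⟩, he, hb, ha⟩

end Transfer

/-! ### Touching squares -/

variable (M) in
/-- The edges of two darts have a common vertex or a common incident face. -/
def Share (d d' : D) : Prop :=
  ∃ a b, M.edge a = M.edge d ∧ M.edge b = M.edge d' ∧
    (M.tail a = M.tail b ∨ M.rightFace a = M.rightFace b)

theorem Share.symm {d d' : D} (h : M.Share d d') : M.Share d' d := by
  obtain ⟨a, b, ha, hb, h⟩ := h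
  exact ⟨b, a, hb, ha, h.imp Eq.symm Eq.symm⟩

theorem share_of_head_eq_tail {d d' : D} (h : M.head d = M.tail d') : M.Share d d' :=
  ⟨M.α d, d', M.edge_α d, rfl, Or.inl h⟩

theorem share_of_leftFace_eq_rightFace {d d' : D} (h : M.leftFace d = M.rightFace d') :
    M.Share d d' :=
  ⟨M.α d, d', M.edge_α d, rfl, Or.inr h⟩

section Touch

variable (hE : M.IsElectrical r) (hdisj : M.SquaresDisjoint r)
include hE hdisj

/-- Two squares on both sides of a horizontal line, with the same horizontal position. -/
theorem IsElectrical.eq_or_share_of_crossX {d d' : D} (hd : M.IsDown r d) (hd' : M.IsDown r d')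
    {U : Set ℝ} (hU : IsUpperSet U) {y : ℝ} (h : M.CrossX r U d) (h' : M.CrossX r U d')
    (hy : M.CrossY r (Set.Ici y) d) (hy' : M.CrossY r (Set.Ioi y) d') :
    d = d' ∨ M.Share d d' := by
  simp only [CrossY, Set.mem_Ici, Set.mem_Ioi, not_le, not_lt] at hy hy'
  rcases hy.2.lt_or_eq with hlt | rfl
  · exact Or.inl (hd.eq_of_cross hE hdisj hd' hU (isUpperSet_Ioi y) h h'
      ⟨by simpa using hy.1.le, hlt⟩ ⟨by simpa using hy'.1, hy'.2⟩)
  · right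
    obtain ⟨e, he, hed, hec⟩ := hE.exists_head_eq_tail hU h
      (hE.not_onEdge_of_potential ((hE.nonneg _).trans_lt hy.1) (hy'.2.trans_le (hE.le_one _)))
    have : e = d' := he.eq_of_cross hE hdisj hd' hU (isUpperSet_Ioi _) hec h'
      ⟨by simp [hed], by have := he.2; rwa [hed] at this⟩ ⟨by simpa using hy'.1, hy'.2⟩
    subst this
    exact (share_of_head_eq_tail hed).symm

/-- Two squares on both sides of a vertical line, with the same vertical position. -/
theorem IsElectrical.eq_or_share_of_crossY {d d' : D} (hd : M.IsDown r d) (hd' : M.IsDown r d')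
    {V : Set ℝ} (hV : IsUpperSet V) {x : ℝ} (h : M.CrossY r V d) (h' : M.CrossY r V d')
    (hx : M.CrossX r (Set.Ici x) d) (hx' : M.CrossX r (Set.Ioi x) d') :
    d = d' ∨ M.Share d d' := by
  simp only [CrossX, Set.mem_Ici, Set.mem_Ioi, not_le, not_lt] at hx hx'
  rcases hx.2.lt_or_eq with hlt | rfl
  · exact Or.inl (hd.eq_of_cross hE hdisj hd' (isUpperSet_Ioi x) hV
      ⟨by simpa using hx.1.le, hlt⟩ ⟨by simpa using hx'.1, hx'.2⟩ h h')
  · right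
    obtain ⟨e, he, hed, hec⟩ := hE.exists_rightFace_eq_leftFace hV h
      (hE.not_onEdge_of_dualPotential ((hE.dual_nonneg _).trans_lt hx.1)
        (hx'.2.trans_le (hE.dual_le _)))
    have : e = d' := he.eq_of_cross hE hdisj hd' (isUpperSet_Ioi _) hV
      ⟨by simp [hed], by have := he.left_sub hE; rwa [hed] at this⟩
      ⟨by simpa using hx'.1, hx'.2⟩ hec h'
    subst this
    exact share_of_leftFace_eq_rightFace hed.symm

/-- If four squares meet at the point `(x, y)`, then the vertices on both sides of this point agree,
or the faces above and below it do.  Indeed, the dart that follows the south-west dart around its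
tail carries a current, as its square would be degenerate and in the centre of the four squares
otherwise, so it is on the edge of the south-east or of the north-west square. -/
theorem IsElectrical.eq_or_eq_of_four (hcross : M.NoDegenerateCross r) {sw nw se ne : D} {x y : ℝ}
    (hsw : M.IsDown r sw) (hnw : M.IsDown r nw) (hse : M.IsDown r se) (hne : M.IsDown r ne)
    (hnwx : M.CrossX r (Set.Ici x) nw) (hnwy : M.CrossY r (Set.Ioi y) nw)
    (hsex : M.CrossX r (Set.Ioi x) se) (hsey : M.CrossY r (Set.Ici y) se)
    (hx : M.dualPotential r (M.leftFace sw) = x) (hy : M.potential r (M.tail sw) = y)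
    (h3 : M.tail se = M.head ne) (h4 : M.leftFace nw = M.rightFace ne)
    (hnex : M.dualPotential r (M.rightFace ne) = x) (hney : M.potential r (M.head ne) = y) :
    M.tail sw = M.head ne ∨ M.leftFace sw = M.rightFace ne := by
  have hy0 : 0 < y := hy ▸ (hE.nonneg _).trans_lt hsw.2
  have hy1 : y < 1 := hney ▸ hne.2.trans_le (hE.le_one _)
  set e := M.σ sw with he
  have het : M.tail e = M.tail sw := M.tail_σ sw
  have her : M.rightFace e = M.leftFace sw := M.rightFace_σ sw
  have hroot : ¬ M.OnEdge r e :=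
    hE.not_onEdge_of_potential (by rwa [hy]) (by rwa [hy]) e het
  have hsub := hE.sub_eq e hroot
  rw [het, her, hx, hy] at hsub
  rcases lt_trichotomy (M.potential r (M.head e)) y with hlt | heq | hgt
  · left
    have hd : M.IsDown r e := ⟨hroot, by rwa [het, hy]⟩
    have : e = se := hd.eq_of_cross hE hdisj hse (isUpperSet_Ioi x) (isUpperSet_Ici y)
      ⟨by simp [her, hx], by simp only [Set.mem_Ioi]; linarith⟩ hsex
      ⟨by simpa using hlt, by simp [het, hy]⟩ hsey
    rw [← het, this, h3]
  · exfalso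
    have hpoint : (M.cornerX r e, M.cornerY r e) = (x, y) := by
      have : M.dualPotential r (M.leftFace e) = x := by linarith
      simp [cornerX, cornerY, this, her, het, hx, hy, heq]
    have hcard := hcross e hroot (by simp [side, het, hy, heq])
    rw [hpoint] at hcard
    simp only [CrossX, CrossY, Set.mem_Ici, Set.mem_Ioi, not_le, not_lt] at hnwx hnwy hsex hsey
    have hinj : ∀ {d d' : D}, M.IsDown r d → M.IsDown r d' → M.square r d = M.square r d' →
        d = d' := by
      intro d d' hd hd' h
      refine hd.eq_of_not_disjoint hdisj hd' ?_
      rw [← h, disjoint_self, hd.interior_square hE]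
      exact (Set.Nonempty.prod (Set.nonempty_Ioo.2 (hd.left_sub hE))
        (Set.nonempty_Ioo.2 hd.2)).ne_empty
    have htail : ∀ {d d' : D}, M.potential r (M.tail d) < M.potential r (M.tail d') →
        d ≠ d' := fun h h' => h.ne (by rw [h'])
    have hface : ∀ {d d' : D}, M.dualPotential r (M.leftFace d) <
        M.dualPotential r (M.leftFace d') → d ≠ d' := fun h h' => h.ne (by rw [h'])
    have hnely : y < M.potential r (M.tail ne) := hney ▸ hne.2
    have hnelx : x < M.dualPotential r (M.leftFace ne) := hnex ▸ hne.left_sub hE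
    have htse : M.potential r (M.tail se) = y := by rw [h3, hney]
    have hlnw : M.dualPotential r (M.leftFace nw) = x := by rw [h4, hnex]
    have hmem : ∀ {d : D}, M.IsDown r d → M.dualPotential r (M.rightFace d) ≤ x →
        x ≤ M.dualPotential r (M.leftFace d) → M.potential r (M.head d) ≤ y →
        y ≤ M.potential r (M.tail d) → M.square r d ∈ {Q | ∃ d' : D, ¬ M.OnEdge r d' ∧
          0 < M.side r d' ∧ Q = M.square r d' ∧ (x, y) ∈ Q} := by
      intro d hd ha hb hc hd'
      refine ⟨d, hd.1, hd.side_pos, rfl, ?_⟩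
      rw [hd.square_eq hE]
      exact ⟨⟨ha, hb⟩, hc, hd'⟩
    have hsub4 : ({M.square r sw, M.square r nw, M.square r se, M.square r ne} :
        Set (Set (ℝ × ℝ))) ⊆ {Q | ∃ d' : D, ¬ M.OnEdge r d' ∧
          0 < M.side r d' ∧ Q = M.square r d' ∧ (x, y) ∈ Q} := by
      rintro Q (rfl | rfl | rfl | rfl)
      · exact hmem hsw (hx ▸ (hsw.left_sub hE).le) hx.ge (hy ▸ hsw.2.le) hy.ge
      · exact hmem hnw hnwx.1.le hnwx.2 hnwy.1 hnwy.2.le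
      · exact hmem hse hsex.1 hsex.2.le hsey.1.le hsey.2
      · exact hmem hne hnex.le hnelx.le hney.le hnely.le
    have h4card : ({M.square r sw, M.square r nw, M.square r se, M.square r ne} :
        Set (Set (ℝ × ℝ))).encard = 4 := by
      rw [Set.encard_insert_of_notMem, Set.encard_insert_of_notMem,
        Set.encard_insert_of_notMem, Set.encard_singleton]
      · norm_num
      · intro h
        exact htail (by rw [htse]; exact hnely) (hinj hse hne h)
      · rintro (h | h)
        · exact htail (by rw [htse]; exact hnwy.2) (hinj hse hnw h.symm)
        · exact hface (by rw [hlnw]; exact hnelx) (hinj hnw hne h)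
      · rintro (h | h | h)
        · exact htail (by rw [hy]; exact hnwy.2) (hinj hsw hnw h)
        · exact hface (by rw [hx]; exact hsex.2) (hinj hsw hse h)
        · exact hface (by rw [hx]; exact hnelx) (hinj hsw hne h)
    exact absurd (Set.encard_le_encard hsub4) (by rw [h4card]; exact hcard.not_ge)
  · right
    have hd : M.IsDown r (M.α e) :=
      ⟨fun h => hroot (M.onEdge_α_iff.1 h), by rwa [head_α, tail_α, het, hy]⟩
    have : M.α e = nw := hd.eq_of_cross hE hdisj hnw (isUpperSet_Ici x) (isUpperSet_Ioi y)
      ⟨by simp only [rightFace_α, Set.mem_Ici, not_le]; linarith, by simp [her, hx]⟩ hnwx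
      ⟨by simp [het, hy], by simpa using hgt⟩ hnwy
    rw [← her, ← leftFace_α, this, h4]

/-- Squares in opposite quadrants, south-west and north-east of a point. -/
theorem IsElectrical.eq_or_share_of_sw_ne (hcross : M.NoDegenerateCross r) {d d' : D} {x y : ℝ}
    (hd : M.IsDown r d) (hd' : M.IsDown r d')
    (hx : M.CrossX r (Set.Ici x) d) (hy : M.CrossY r (Set.Ici y) d)
    (hx' : M.CrossX r (Set.Ioi x) d') (hy' : M.CrossY r (Set.Ioi y) d') :
    d = d' ∨ M.Share d d' := by
  have hx2 := hx
  have hy2 := hy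
  have hx2' := hx'
  have hy2' := hy'
  simp only [CrossX, CrossY, Set.mem_Ici, Set.mem_Ioi, not_le, not_lt] at hx2 hy2 hx2' hy2'
  rcases hy2.2.lt_or_eq with hlt | hyeq
  · exact hE.eq_or_share_of_crossY hdisj hd hd' (isUpperSet_Ioi y)
      ⟨by simpa using hy2.1.le, hlt⟩ hy' hx hx'
  rcases hx2.2.lt_or_eq with hlt | hxeq
  · exact hE.eq_or_share_of_crossX hdisj hd hd' (isUpperSet_Ioi x)
      ⟨by simpa using hx2.1.le, hlt⟩ hx' hy hy'
  rcases hy2'.1.lt_or_eq with hlt | hyeq'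
  · exact hE.eq_or_share_of_crossY hdisj hd hd' (isUpperSet_Ici y) hy
      ⟨by simpa using hlt, hy2'.2.le⟩ hx hx'
  rcases hx2'.1.lt_or_eq with hlt | hxeq'
  · exact hE.eq_or_share_of_crossX hdisj hd hd' (isUpperSet_Ici x) hx
      ⟨by simpa using hlt, hx2'.2.le⟩ hy hy'
  right
  have hy0 : 0 < y := (hE.nonneg _).trans_lt hy2.1
  have hy1 : y < 1 := hy2'.2.trans_le (hE.le_one _)
  have hx0 : 0 < x := (hE.dual_nonneg _).trans_lt hx2.1
  have hx1 : x < M.totalCurrent r := hx2'.2.trans_le (hE.dual_le _)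
  obtain ⟨nw, hnw, hnwh, hnwx⟩ := hE.exists_head_eq_tail (isUpperSet_Ici x) hx
    (hE.not_onEdge_of_potential (by rwa [← hyeq]) (by rwa [← hyeq]))
  obtain ⟨se, hse, hser, hsey⟩ := hE.exists_rightFace_eq_leftFace (isUpperSet_Ici y) hy
    (hE.not_onEdge_of_dualPotential (by rwa [← hxeq]) (by rwa [← hxeq]))
  obtain ⟨se', hse', hset, hsex'⟩ := hE.exists_tail_eq_head (isUpperSet_Ioi x) hx'
    (hE.not_onEdge_of_potential (by rwa [hyeq']) (by rwa [hyeq']))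
  obtain ⟨nw', hnw', hnwl, hnwy'⟩ := hE.exists_leftFace_eq_rightFace (isUpperSet_Ioi y) hy'
    (hE.not_onEdge_of_dualPotential (by rwa [hxeq']) (by rwa [hxeq']))
  have hnwy : M.CrossY r (Set.Ioi y) nw :=
    ⟨by simp [hnwh, ← hyeq], by have := hnw.2; rwa [hnwh, ← hyeq] at this⟩
  have hnwx' : M.CrossX r (Set.Ici x) nw' :=
    ⟨by have := hnw'.left_sub hE; rw [hnwl, hxeq'] at this; simpa using this,
      by simp [hnwl, hxeq']⟩
  have hsex : M.CrossX r (Set.Ioi x) se :=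
    ⟨by simp [hser, ← hxeq], by have := hse.left_sub hE; rwa [hser, ← hxeq] at this⟩
  have hsey' : M.CrossY r (Set.Ici y) se' :=
    ⟨by have := hse'.2; rw [hset, hyeq'] at this; simpa using this, by simp [hset, hyeq']⟩
  obtain rfl := hnw.eq_of_cross hE hdisj hnw' (isUpperSet_Ici x) (isUpperSet_Ioi y) hnwx hnwx'
    hnwy hnwy'
  obtain rfl := hse.eq_of_cross hE hdisj hse' (isUpperSet_Ioi x) (isUpperSet_Ici y) hsex hsex'
    hsey hsey'
  rcases hE.eq_or_eq_of_four hdisj hcross hd hnw hse hd' hnwx hnwy hsex hsey hxeq.symm hyeq.symm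
    hset hnwl hxeq' hyeq' with h | h
  · exact (share_of_head_eq_tail h.symm).symm
  · exact share_of_leftFace_eq_rightFace h

/-- Squares in opposite quadrants, north-west and south-east of a point. -/
theorem IsElectrical.eq_or_share_of_nw_se (hcross : M.NoDegenerateCross r) {d d' : D} {x y : ℝ}
    (hd : M.IsDown r d) (hd' : M.IsDown r d')
    (hx : M.CrossX r (Set.Ici x) d) (hy : M.CrossY r (Set.Ioi y) d)
    (hx' : M.CrossX r (Set.Ioi x) d') (hy' : M.CrossY r (Set.Ici y) d') :
    d = d' ∨ M.Share d d' := by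
  have hx2 := hx
  have hy2 := hy
  have hx2' := hx'
  have hy2' := hy'
  simp only [CrossX, CrossY, Set.mem_Ici, Set.mem_Ioi, not_le, not_lt] at hx2 hy2 hx2' hy2'
  have swap : d' = d ∨ M.Share d' d → d = d' ∨ M.Share d d' := Or.imp Eq.symm Share.symm
  rcases hy2.1.lt_or_eq with hlt | hyeq
  · exact hE.eq_or_share_of_crossY hdisj hd hd' (isUpperSet_Ici y)
      ⟨by simpa using hlt, hy2.2.le⟩ hy' hx hx'
  rcases hx2.2.lt_or_eq with hlt | hxeq
  · exact swap (hE.eq_or_share_of_crossX hdisj hd' hd (isUpperSet_Ioi x)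
      hx' ⟨by simpa using hx2.1.le, hlt⟩ hy' hy)
  rcases hy2'.2.lt_or_eq with hlt | hyeq'
  · exact hE.eq_or_share_of_crossY hdisj hd hd' (isUpperSet_Ioi y) hy
      ⟨by simpa using hy2'.1.le, hlt⟩ hx hx'
  rcases hx2'.1.lt_or_eq with hlt | hxeq'
  · exact swap (hE.eq_or_share_of_crossX hdisj hd' hd (isUpperSet_Ici x)
      ⟨by simpa using hlt, hx2'.2.le⟩ hx hy' hy)
  right
  have hy0 : 0 < y := (hE.nonneg _).trans_lt hy2'.1
  have hy1 : y < 1 := hy2.2.trans_le (hE.le_one _)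
  have hx0 : 0 < x := (hE.dual_nonneg _).trans_lt hx2.1
  have hx1 : x < M.totalCurrent r := hx2'.2.trans_le (hE.dual_le _)
  obtain ⟨sw, hsw, hswt, hswx⟩ := hE.exists_tail_eq_head (isUpperSet_Ici x) hx
    (hE.not_onEdge_of_potential (by rwa [hyeq]) (by rwa [hyeq]))
  obtain ⟨ne, hne, hner, hney⟩ := hE.exists_rightFace_eq_leftFace (isUpperSet_Ioi y) hy
    (hE.not_onEdge_of_dualPotential (by rwa [← hxeq]) (by rwa [← hxeq]))
  obtain ⟨ne', hne', hneh, hnex'⟩ := hE.exists_head_eq_tail (isUpperSet_Ioi x) hx'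
    (hE.not_onEdge_of_potential (by rwa [← hyeq']) (by rwa [← hyeq']))
  obtain ⟨sw', hsw', hswl, hswy'⟩ := hE.exists_leftFace_eq_rightFace (isUpperSet_Ici y) hy'
    (hE.not_onEdge_of_dualPotential (by rwa [hxeq']) (by rwa [hxeq']))
  have hswy : M.CrossY r (Set.Ici y) sw :=
    ⟨by have := hsw.2; rw [hswt, hyeq] at this; simpa using this, by simp [hswt, hyeq]⟩
  have hswx' : M.CrossX r (Set.Ici x) sw' :=
    ⟨by have := hsw'.left_sub hE; rw [hswl, hxeq'] at this; simpa using this,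
      by simp [hswl, hxeq']⟩
  have hnex : M.CrossX r (Set.Ioi x) ne :=
    ⟨by simp [hner, ← hxeq], by have := hne.left_sub hE; rwa [hner, ← hxeq] at this⟩
  have hney' : M.CrossY r (Set.Ioi y) ne' :=
    ⟨by simp [hneh, ← hyeq'], by have := hne'.2; rwa [hneh, ← hyeq'] at this⟩
  obtain rfl := hsw.eq_of_cross hE hdisj hsw' (isUpperSet_Ici x) (isUpperSet_Ici y) hswx hswx'
    hswy hswy'
  obtain rfl := hne.eq_of_cross hE hdisj hne' (isUpperSet_Ioi x) (isUpperSet_Ioi y) hnex hnex'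
    hney hney'
  rcases hE.eq_or_eq_of_four hdisj hcross hsw hd hd' hne hx hy hx' hy'
    (by rw [hswl, hxeq']) (by rw [hswt, hyeq]) hneh.symm hner.symm
    (by rw [hner, ← hxeq]) (by rw [hneh, ← hyeq']) with h | h
  · exact share_of_head_eq_tail (by rw [← hswt, h, hneh])
  · exact share_of_leftFace_eq_rightFace (by rw [← hswl, h, hner])

/-- The edges of two intersecting squares have a common vertex or a common incident face. -/
theorem IsElectrical.eq_or_share_of_mem_square (hcross : M.NoDegenerateCross r) {d d' : D}
    (hd : M.IsDown r d) (hd' : M.IsDown r d') {p : ℝ × ℝ} (hp : p ∈ M.square r d)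
    (hp' : p ∈ M.square r d') : d = d' ∨ M.Share d d' := by
  obtain ⟨x, y⟩ := p
  have quadrant : ∀ {d}, M.IsDown r d → (x, y) ∈ M.square r d →
      (M.CrossX r (Set.Ici x) d ∨ M.CrossX r (Set.Ioi x) d) ∧
        (M.CrossY r (Set.Ici y) d ∨ M.CrossY r (Set.Ioi y) d) := by
    intro d hd hp
    have side : ∀ {a b z : ℝ}, a < b → a ≤ z → z ≤ b →
        (a ∉ Set.Ici z ∧ b ∈ Set.Ici z) ∨ (a ∉ Set.Ioi z ∧ b ∈ Set.Ioi z) := by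
      intro a b z hab haz hzb
      simp only [Set.mem_Ici, Set.mem_Ioi, not_le, not_lt]
      rcases haz.lt_or_eq with h | h
      · exact Or.inl ⟨h, hzb⟩
      · exact Or.inr ⟨haz, h ▸ hab⟩
    rw [hd.square_eq hE] at hp
    exact ⟨side (hd.left_sub hE) hp.1.1 hp.1.2, side hd.2 hp.2.1 hp.2.2⟩
  have swap : d' = d ∨ M.Share d' d → d = d' ∨ M.Share d d' := Or.imp Eq.symm Share.symm
  obtain ⟨hx | hx, hy | hy⟩ := quadrant hd hp <;>
    obtain ⟨hx' | hx', hy' | hy'⟩ := quadrant hd' hp'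
  · exact Or.inl (hd.eq_of_cross hE hdisj hd' (isUpperSet_Ici x) (isUpperSet_Ici y) hx hx' hy hy')
  · exact hE.eq_or_share_of_crossX hdisj hd hd' (isUpperSet_Ici x) hx hx' hy hy'
  · exact hE.eq_or_share_of_crossY hdisj hd hd' (isUpperSet_Ici y) hy hy' hx hx'
  · exact hE.eq_or_share_of_sw_ne hdisj hcross hd hd' hx hy hx' hy'
  · exact swap (hE.eq_or_share_of_crossX hdisj hd' hd (isUpperSet_Ici x) hx' hx hy' hy)
  · exact Or.inl (hd.eq_of_cross hE hdisj hd' (isUpperSet_Ici x) (isUpperSet_Ioi y) hx hx' hy hy')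
  · exact hE.eq_or_share_of_nw_se hdisj hcross hd hd' hx hy hx' hy'
  · exact hE.eq_or_share_of_crossY hdisj hd hd' (isUpperSet_Ioi y) hy hy' hx hx'
  · exact swap (hE.eq_or_share_of_crossY hdisj hd' hd (isUpperSet_Ici y) hy' hy hx' hx)
  · exact swap (hE.eq_or_share_of_nw_se hdisj hcross hd' hd hx' hy' hx hy)
  · exact Or.inl (hd.eq_of_cross hE hdisj hd' (isUpperSet_Ioi x) (isUpperSet_Ici y) hx hx' hy hy')
  · exact hE.eq_or_share_of_crossX hdisj hd hd' (isUpperSet_Ioi x) hx hx' hy hy'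
  · exact swap (hE.eq_or_share_of_sw_ne hdisj hcross hd' hd hx' hy' hx hy)
  · exact swap (hE.eq_or_share_of_crossY hdisj hd' hd (isUpperSet_Ioi y) hy' hy hx' hx)
  · exact swap (hE.eq_or_share_of_crossX hdisj hd' hd (isUpperSet_Ioi x) hx' hx hy' hy)
  · exact Or.inl (hd.eq_of_cross hE hdisj hd' (isUpperSet_Ioi x) (isUpperSet_Ioi y) hx hx' hy hy')

omit hdisj in
/-- The edge of a square that touches the boundary of the rectangle has a common vertex or a common
incident face with the root edge: otherwise there would be another square beyond the boundary. -/
theorem IsElectrical.share_root {d : D} (hd : M.IsDown r d) {p : ℝ × ℝ} (hp : p ∈ M.square r d)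
    (hp' : p ∉ Set.Ioo 0 (M.totalCurrent r) ×ˢ Set.Ioo (0 : ℝ) 1) : M.Share d r := by
  by_contra hs
  have hedge : ∀ {e}, M.OnEdge r e → M.edge e = M.edge r := by
    rintro e (rfl | rfl)
    · rfl
    · exact M.edge_α r
  have hX : M.CrossX r (Set.Ioi (M.dualPotential r (M.rightFace d))) d :=
    ⟨by simp, hd.left_sub hE⟩
  have hY : M.CrossY r (Set.Ioi (M.potential r (M.head d))) d := ⟨by simp, hd.2⟩
  obtain ⟨top, htop, h1, -⟩ := hE.exists_head_eq_tail (isUpperSet_Ioi _) hX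
    fun e he hr => hs ⟨d, e, rfl, hedge hr, Or.inl he.symm⟩
  obtain ⟨bot, hbot, h2, -⟩ := hE.exists_tail_eq_head (isUpperSet_Ioi _) hX
    fun e he hr => hs ⟨M.α d, e, M.edge_α d, hedge hr, Or.inl he.symm⟩
  obtain ⟨west, hwest, h3, -⟩ := hE.exists_leftFace_eq_rightFace (isUpperSet_Ioi _) hY
    fun e he hr => hs ⟨d, e, rfl, hedge hr, Or.inr he.symm⟩
  obtain ⟨east, heast, h4, -⟩ := hE.exists_rightFace_eq_leftFace (isUpperSet_Ioi _) hY
    fun e he hr => hs ⟨M.α d, e, M.edge_α d, hedge hr, Or.inr he.symm⟩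
  rw [hd.square_eq hE] at hp
  refine hp' ⟨⟨?_, ?_⟩, ?_, ?_⟩
  · have := hwest.left_sub hE
    rw [h3] at this
    exact ((hE.dual_nonneg _).trans_lt this).trans_le hp.1.1
  · have := heast.left_sub hE
    rw [h4] at this
    exact hp.1.2.trans_lt (this.trans_le (hE.dual_le _))
  · have := hbot.2
    rw [h2] at this
    exact ((hE.nonneg _).trans_lt this).trans_le hp.2.1
  · have := htop.2
    rw [h1] at this
    exact hp.2.2.trans_lt (this.trans_le (hE.le_one _))

end Touch

end CombMap

namespace CombMap

variable {D : Type*} {M : CombMap D} {r : D}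

/-! ### Degenerate squares -/

/-- The degenerate square of an edge without current is a corner of a square of positive side. -/
theorem IsElectrical.exists_corner (hE : M.IsElectrical r) {d : D} (hd : ¬ M.OnEdge r d)
    (h0 : M.potential r (M.tail d) = M.potential r (M.head d)) :
    ∃ d', M.IsDown r d' ∧
      (M.dualPotential r (M.rightFace d) = M.dualPotential r (M.rightFace d') ∨
        M.dualPotential r (M.rightFace d) = M.dualPotential r (M.leftFace d')) ∧
      (M.potential r (M.tail d) = M.potential r (M.tail d') ∨
        M.potential r (M.tail d) = M.potential r (M.head d')) := by
  set x := M.dualPotential r (M.rightFace d) with hx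
  set y := M.potential r (M.tail d) with hy
  -- otherwise all darts have their degenerate squares at the same point, also the root
  by_contra hcon
  have key := hE.network.forall_of_exists (p := fun e => ¬ M.OnEdge r e ∧
    M.potential r (M.tail e) = M.potential r (M.head e) ∧
    M.dualPotential r (M.rightFace e) = x ∧ M.potential r (M.tail e) = y) ?_ ?_
    (d := d) ⟨hd, h0, rfl, rfl⟩ r
  · exact key.1 (Or.inl rfl)
  · rintro e ⟨he, he0, hex, hey⟩
    have hex' : M.dualPotential r (M.rightFace (M.σ e)) = x := by
      rw [rightFace_σ, ← hex]
      linarith [hE.sub_eq e he]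
    have hey' : M.potential r (M.tail (M.σ e)) = y := by rw [tail_σ, hey]
    generalize M.σ e = e' at hex' hey'
    by_cases hroot : M.OnEdge r e'
    · exfalso
      rcases hroot with rfl | rfl
      · -- the corner of the rectangle at the tail of the root
        have hxl : x = M.totalCurrent e' := hex'.symm.trans hE.dual_right
        have hy1 : y = 1 := hey'.symm.trans hE.potential_tail
        obtain ⟨a, hat, hab, haa⟩ := hE.network.exists_crossing
          (before := fun a => M.dualPotential e' (M.rightFace a) ≠ M.totalCurrent e')
          (after := fun a => M.dualPotential e' (M.leftFace a) ≠ M.totalCurrent e') (d := e')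
          (fun a => by rw [rightFace_σ]) (by simpa using hE.dual_right)
          (by rw [hE.dual_left]; exact hE.pos.ne)
        rw [not_not] at haa
        have ha : ¬ M.OnEdge e' a := by
          rintro (rfl | rfl)
          · exact hab hE.dual_right
          · have := hE.potential_head
            rw [← tail_α, hat, hE.potential_tail] at this
            exact one_ne_zero this
        have hlt := (hE.dual_le (M.rightFace a)).lt_of_ne hab
        refine hcon ⟨a, ⟨ha, by linarith [hE.sub_eq a ha]⟩, Or.inr (by rw [hxl, haa]),
          Or.inl (by rw [hat, hE.potential_tail, hy1])⟩
      · -- the corner of the rectangle at the head of the root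
        have hxl : x = 0 := hex'.symm.trans hE.dual_left
        have hy0 : y = 0 := hey'.symm.trans hE.potential_head
        obtain ⟨a, hat, hab, haa⟩ := hE.network.exists_crossing
          (before := fun a => M.dualPotential r (M.rightFace a) ≠ 0)
          (after := fun a => M.dualPotential r (M.leftFace a) ≠ 0) (d := M.α r)
          (fun a => by rw [rightFace_σ]) (by simpa using hE.dual_left)
          (by rw [leftFace_α, hE.dual_right]; exact hE.pos.ne')
        rw [not_not] at haa
        have ha : ¬ M.OnEdge r a := by
          rintro (rfl | rfl)
          · have := hE.potential_tail
            rw [hat, tail_α, hE.potential_head] at this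
            exact zero_ne_one this
          · exact hab hE.dual_left
        have hlt := (hE.dual_nonneg (M.rightFace a)).lt_of_ne' hab
        refine hcon ⟨M.α a, ⟨fun h => ha (M.onEdge_α_iff.1 h), ?_⟩, Or.inl ?_, Or.inr ?_⟩
        · rw [head_α, tail_α]
          linarith [hE.sub_eq a ha]
        · rw [rightFace_α, haa, hxl]
        · rw [head_α, hat, tail_α, hE.potential_head, hy0]
    · refine ⟨hroot, ?_, hex', hey'⟩
      by_contra hne
      rcases lt_or_gt_of_ne hne with h | h
      · refine hcon ⟨M.α e', ⟨fun h => hroot (M.onEdge_α_iff.1 h), by rwa [head_α, tail_α]⟩,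
          Or.inr ?_, Or.inr ?_⟩
        · rw [leftFace_α, hex']
        · rw [head_α, hey']
      · exact hcon ⟨e', ⟨hroot, h⟩, Or.inl hex'.symm, Or.inl hey'.symm⟩
  · rintro e ⟨he, he0, hex, hey⟩
    refine ⟨fun h => he (M.onEdge_α_iff.1 h), ?_, ?_, ?_⟩
    · rw [tail_α, head_α, he0]
    · rw [rightFace_α, ← hex]
      linarith [hE.sub_eq e he]
    · rw [tail_α, ← he0, hey]

theorem IsElectrical.square_eq_singleton (hE : M.IsElectrical r) {d : D} (hd : ¬ M.OnEdge r d)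
    (h0 : M.potential r (M.tail d) = M.potential r (M.head d)) :
    M.square r d = {(M.dualPotential r (M.rightFace d), M.potential r (M.tail d))} := by
  have h1 : M.dualPotential r (M.leftFace d) = M.dualPotential r (M.rightFace d) := by
    linarith [hE.sub_eq d hd]
  simp [square, cornerX, cornerY, side, h1, ← h0]

theorem isDown_or_degenerate {d : D} (hd : ¬ M.OnEdge r d) :
    (∃ d', M.IsDown r d' ∧ M.square r d' = M.square r d) ∨
      M.potential r (M.tail d) = M.potential r (M.head d) := by
  rcases (abs_nonneg (M.potential r (M.tail d) - M.potential r (M.head d))).lt_or_eq with h | h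
  · left
    rcases isDown_or_isDown_α hd h with h | h
    · exact ⟨d, h, rfl⟩
    · exact ⟨M.α d, h, square_α d⟩
  · exact Or.inr (sub_eq_zero.1 (abs_eq_zero.1 h.symm))

theorem isClosed_square (d : D) : IsClosed (M.square r d) := isClosed_Icc.prod isClosed_Icc

theorem IsDown.isPreconnected_interior (hE : M.IsElectrical r) {d : D} (hd : M.IsDown r d) :
    IsPreconnected (interior (M.square r d)) := by
  rw [hd.interior_square hE]
  exact isPreconnected_Ioo.prod isPreconnected_Ioo

theorem IsDown.closure_interior (hE : M.IsElectrical r) {d : D} (hd : M.IsDown r d) :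
    closure (interior (M.square r d)) = M.square r d := by
  rw [hd.interior_square hE, closure_prod_eq, closure_Ioo (hd.left_sub hE).ne,
    closure_Ioo hd.2.ne, hd.square_eq hE]

theorem IsDown.eq_of_mem_square_of_mem_interior (hE : M.IsElectrical r)
    (hdisj : M.SquaresDisjoint r) {d d' : D} (hd : M.IsDown r d) (hd' : M.IsDown r d')
    {p : ℝ × ℝ} (hp : p ∈ interior (M.square r d)) (hp' : p ∈ M.square r d') : d = d' := by
  refine hd.eq_of_not_disjoint hdisj hd' fun h => ?_
  rw [← hd'.closure_interior hE] at hp'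
  exact Set.disjoint_left.1 (h.closure_right isOpen_interior) hp hp'

/-- The squaring does not enter the squares. -/
theorem IsDown.disjoint_squaring (hE : M.IsElectrical r) (hdisj : M.SquaresDisjoint r) {d : D}
    (hd : M.IsDown r d) : Disjoint (interior (M.square r d)) (M.squaring r) := by
  refine Disjoint.closure_right ?_ isOpen_interior
  simp only [Set.disjoint_iUnion_right]
  intro e he
  rw [Set.disjoint_left]
  intro p hp hp'
  rcases isDown_or_degenerate he with ⟨d', hd', heq⟩ | h0
  · rw [← heq] at hp'
    obtain rfl := hd.eq_of_mem_square_of_mem_interior hE hdisj hd' hp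
      ((isClosed_square d').frontier_subset hp')
    exact hp'.2 hp
  · obtain ⟨d', hd', hx, hy⟩ := hE.exists_corner he h0
    have hpe := (isClosed_square e).frontier_subset hp'
    rw [hE.square_eq_singleton he h0, Set.mem_singleton_iff] at hpe
    subst hpe
    have hp'd : (M.dualPotential r (M.rightFace e), M.potential r (M.tail e)) ∈
        M.square r d' := by
      rw [hd'.square_eq hE]
      have h1 := (hd'.left_sub hE).le
      have h2 := hd'.2.le
      rcases hx with hx | hx <;> rcases hy with hy | hy <;> rw [hx, hy] <;>
        exact ⟨⟨by simp [h1], by simp [h1]⟩, by simp [h2], by simp [h2]⟩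
    obtain rfl := hd.eq_of_mem_square_of_mem_interior hE hdisj hd' hp hp'd
    rw [hd.interior_square hE] at hp
    rcases hx with hx | hx
    · exact hp.1.1.ne hx.symm
    · exact hp.1.2.ne hx

/-! ### The components of the complement of the squaring -/

theorem IsDown.square_subset (hE : M.IsElectrical r) {d : D} (hd : M.IsDown r d) :
    M.square r d ⊆ Set.Icc 0 (M.totalCurrent r) ×ˢ Set.Icc (0 : ℝ) 1 := by
  rw [hd.square_eq hE]
  exact Set.prod_mono (Set.Icc_subset_Icc (hE.dual_nonneg _) (hE.dual_le _))
    (Set.Icc_subset_Icc (hE.nonneg _) (hE.le_one _))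

theorem IsElectrical.squaring_subset (hE : M.IsElectrical r) :
    M.squaring r ⊆ Set.Icc 0 (M.totalCurrent r) ×ˢ Set.Icc (0 : ℝ) 1 := by
  refine closure_minimal (Set.iUnion₂_subset fun e he => ?_) (isClosed_Icc.prod isClosed_Icc)
  refine (isClosed_square e).frontier_subset.trans ?_
  rcases isDown_or_degenerate he with ⟨d', hd', heq⟩ | h0
  · rw [← heq]
    exact hd'.square_subset hE
  · rw [hE.square_eq_singleton he h0, Set.singleton_subset_iff]
    exact ⟨⟨hE.dual_nonneg _, hE.dual_le _⟩, hE.nonneg _, hE.le_one _⟩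

/-- The squares of positive side have the total area of the rectangle. -/
theorem IsElectrical.hasSum_area (hE : M.IsElectrical r) :
    HasSum (fun d : {d // M.IsDown r d} => M.side r d ^ 2) (M.totalCurrent r) := by
  set F : D → ℝ := {d | M.IsDown r d}.indicator fun d => M.side r d ^ 2 with hF
  have hsplit : ∀ d, ({d | ¬ M.OnEdge r d}.indicator fun d => M.side r d ^ 2) d =
      F d + F (M.α d) := by
    intro d
    by_cases hd : M.OnEdge r d
    · have h1 : ¬ M.IsDown r d := fun h => h.1 hd
      have h2 : ¬ M.IsDown r (M.α d) := fun h => h.1 (M.onEdge_α_iff.2 hd)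
      simp [hF, hd, h1, h2]
    rw [Set.indicator_of_mem (by simpa using hd)]
    have hd' : ¬ M.OnEdge r (M.α d) := fun h => hd (M.onEdge_α_iff.1 h)
    rcases lt_trichotomy (M.potential r (M.tail d)) (M.potential r (M.head d)) with h | h | h
    · have h1 : ¬ M.IsDown r d := fun h' => h.not_gt h'.2
      have h2 : M.IsDown r (M.α d) := ⟨hd', by rwa [head_α, tail_α]⟩
      simp [hF, h1, h2, side_α]
    · have h1 : ¬ M.IsDown r d := fun h' => h'.2.ne' h
      have h2 : ¬ M.IsDown r (M.α d) := fun h' => by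
        have := h'.2
        rw [head_α, tail_α] at this
        exact this.ne h
      simp [hF, h1, h2, side, h]
    · have h1 : M.IsDown r d := ⟨hd, h⟩
      have h2 : ¬ M.IsDown r (M.α d) := fun h' => by
        have := h'.2
        rw [head_α, tail_α] at this
        exact this.not_gt h
      simp [hF, h1, h2]
  have hF0 : ∀ d, 0 ≤ F d := fun d => Set.indicator_nonneg (fun _ _ => sq_nonneg _) d
  have hsum : Summable F := Summable.of_nonneg_of_le hF0
    (fun d => by rw [hsplit]; linarith [hF0 (M.α d)]) hE.hasSum.summable
  have h1 := hsum.hasSum.add ((Equiv.hasSum_iff M.α).2 hsum.hasSum)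
  have h2 := hE.hasSum.unique (h1.congr_fun hsplit)
  have h3 : ∑' d, F d = M.totalCurrent r := by linarith
  rw [← h3]
  exact (hasSum_subtype_iff_indicator (s := {d | M.IsDown r d})).2 hsum.hasSum

theorem IsDown.volume_interior (hE : M.IsElectrical r) {d : D} (hd : M.IsDown r d) :
    MeasureTheory.volume (interior (M.square r d)) = ENNReal.ofReal (M.side r d ^ 2) := by
  rw [hd.interior_square hE, MeasureTheory.Measure.volume_eq_prod,
    MeasureTheory.Measure.prod_prod, Real.volume_Ioo, Real.volume_Ioo,
    hE.sub_eq d hd.1, ← ENNReal.ofReal_mul (sub_pos.2 hd.2).le, side, sq_abs, sq]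

/-- The squares are dense in the rectangle, because their total area is the area of the
rectangle. -/
theorem IsElectrical.exists_interior_inter_nonempty (hE : M.IsElectrical r)
    (hdisj : M.SquaresDisjoint r) {W : Set (ℝ × ℝ)} (hW : IsOpen W) {p : ℝ × ℝ} (hp : p ∈ W)
    (hp' : p ∈ Set.Icc 0 (M.totalCurrent r) ×ˢ Set.Icc (0 : ℝ) 1) :
    ∃ d, M.IsDown r d ∧ (W ∩ interior (M.square r d)).Nonempty := by
  by_contra! hcon
  set R : Set (ℝ × ℝ) := Set.Ioo 0 (M.totalCurrent r) ×ˢ Set.Ioo (0 : ℝ) 1 with hR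
  have hRo : IsOpen R := isOpen_Ioo.prod isOpen_Ioo
  have hRvol : MeasureTheory.volume R = ENNReal.ofReal (M.totalCurrent r) := by
    rw [hR, MeasureTheory.Measure.volume_eq_prod, MeasureTheory.Measure.prod_prod,
      Real.volume_Ioo, Real.volume_Ioo]
    simp
  have hWR : (W ∩ R).Nonempty := by
    have : p ∈ closure R := by
      rwa [hR, closure_prod_eq, closure_Ioo hE.pos.ne, closure_Ioo one_ne_zero.symm]
    exact mem_closure_iff.1 this W hW hp
  have hWpos := (hW.inter hRo).measure_pos MeasureTheory.volume hWR
  let Q : {d // M.IsDown r d} → Set (ℝ × ℝ) := fun d => interior (M.square r d)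
  have hQo : IsOpen (⋃ d, Q d) := isOpen_iUnion fun d => isOpen_interior
  have hQsum : ∑' d, MeasureTheory.volume (Q d) = ENNReal.ofReal (M.totalCurrent r) := by
    rw [← hE.hasSum_area.tsum_eq, ENNReal.ofReal_tsum_of_nonneg (fun d => sq_nonneg _)
      hE.hasSum_area.summable]
    exact tsum_congr fun d => d.2.volume_interior hE
  have hQvol := MeasureTheory.tsum_meas_le_meas_iUnion_of_disjoint MeasureTheory.volume
    (As := Q) (fun d => isOpen_interior.measurableSet) (fun d d' hne => by
      by_contra h
      exact hne (Subtype.ext (d.2.eq_of_not_disjoint hdisj d'.2 h)))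
  have hdis : Disjoint (W ∩ R) (⋃ d, Q d) := by
    refine Set.disjoint_iUnion_right.2 fun d => ?_
    rw [Set.disjoint_iff_inter_eq_empty]
    exact Set.subset_eq_empty (Set.inter_subset_inter_left _ Set.inter_subset_left)
      (hcon d d.2)
  have hsub : (W ∩ R) ∪ ⋃ d, Q d ⊆ R := by
    refine Set.union_subset Set.inter_subset_right (Set.iUnion_subset fun d => ?_)
    refine (interior_mono (d.2.square_subset hE)).trans ?_
    rw [interior_prod_eq, interior_Icc, interior_Icc]
  have hle := MeasureTheory.measure_mono (μ := MeasureTheory.volume) hsub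
  rw [MeasureTheory.measure_union hdis hQo.measurableSet, hRvol] at hle
  rw [hQsum] at hQvol
  have := (add_le_add_right hQvol (MeasureTheory.volume (W ∩ R))).trans hle
  rw [add_comm] at this
  exact absurd this (not_le.2 (ENNReal.lt_add_right ENNReal.ofReal_ne_top hWpos.ne'))

variable (M r) in
/-- The exterior of the rectangle of the squaring. -/
def exterior : Set (ℝ × ℝ) := (Set.Icc 0 (M.totalCurrent r) ×ˢ Set.Icc (0 : ℝ) 1)ᶜ

theorem isPreconnected_exterior : IsPreconnected (M.exterior r) := by
  set l := M.totalCurrent r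
  have h : M.exterior r = ((Set.Iio 0 ×ˢ Set.univ ∪ Set.univ ×ˢ Set.Iio 0) ∪
      Set.Ioi l ×ˢ Set.univ) ∪ Set.univ ×ˢ Set.Ioi 1 := by
    ext ⟨x, y⟩
    simp only [exterior, Set.mem_compl_iff, Set.mem_prod, Set.mem_Icc, Set.mem_union,
      Set.mem_Iio, Set.mem_Ioi, Set.mem_univ, and_true, true_and, ← not_le]
    tauto
  rw [h]
  have hA : IsPreconnected (Set.Iio (0 : ℝ) ×ˢ (Set.univ : Set ℝ)) :=
    isPreconnected_Iio.prod isPreconnected_univ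
  have hB : IsPreconnected ((Set.univ : Set ℝ) ×ˢ Set.Iio (0 : ℝ)) :=
    isPreconnected_univ.prod isPreconnected_Iio
  have hC : IsPreconnected (Set.Ioi l ×ˢ (Set.univ : Set ℝ)) :=
    isPreconnected_Ioi.prod isPreconnected_univ
  have hD : IsPreconnected ((Set.univ : Set ℝ) ×ˢ Set.Ioi (1 : ℝ)) :=
    isPreconnected_univ.prod isPreconnected_Ioi
  refine ((hA.union (-1, -1) (by simp) (by simp) hB).union (l + 1, -1) (by simp) (by simp)
    hC).union (l + 1, 2) (by simp) (by simp) hD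

/-- The components of the complement of the squaring are the interiors of the squares of positive
side and the exterior of the rectangle. -/
theorem IsElectrical.eq_of_mem_complComponents (hE : M.IsElectrical r)
    (hdisj : M.SquaresDisjoint r) {C : Set (ℝ × ℝ)} (hC : C ∈ complComponents (M.squaring r)) :
    (∃ d, M.IsDown r d ∧ C = interior (M.square r d)) ∨ C = M.exterior r := by
  obtain ⟨p, hp, rfl⟩ := hC
  set C := connectedComponentIn (M.squaring r)ᶜ p with hCdef
  have hCsub : C ⊆ (M.squaring r)ᶜ := connectedComponentIn_subset _ _
  have hpC : p ∈ C := mem_connectedComponentIn hp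
  have hpre : IsPreconnected C := isPreconnected_connectedComponentIn
  have hsub : ∀ {A : Set (ℝ × ℝ)}, IsPreconnected A → A ⊆ (M.squaring r)ᶜ → (C ∩ A).Nonempty →
      A ⊆ C := by
    rintro A hA hAS ⟨q, hqC, hqA⟩
    rw [hCdef, connectedComponentIn_eq hqC]
    exact hA.subset_connectedComponentIn hqA hAS
  have hint : ∀ d, M.IsDown r d → (C ∩ interior (M.square r d)).Nonempty →
      C = interior (M.square r d) := by
    intro d hd hne
    refine Set.Subset.antisymm ?_ (hsub (hd.isPreconnected_interior hE)
      (hd.disjoint_squaring hE hdisj).subset_compl_right hne)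
    refine hpre.subset_left_of_subset_union isOpen_interior (isClosed_square d).isOpen_compl
      (disjoint_compl_right.mono_left interior_subset) (fun q hq => ?_) hne
    by_contra hq'
    rw [Set.mem_union, not_or, Set.mem_compl_iff, not_not] at hq'
    refine hCsub hq (subset_closure (Set.mem_iUnion₂.2 ⟨d, hd.1, ?_⟩))
    rw [(isClosed_square d).frontier_eq]
    exact ⟨hq'.2, hq'.1⟩
  have hopen : IsOpen C := (isClosed_closure.isOpen_compl).connectedComponentIn
  by_cases hCR : (C ∩ Set.Icc 0 (M.totalCurrent r) ×ˢ Set.Icc (0 : ℝ) 1).Nonempty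
  · left
    obtain ⟨q, hqC, hq⟩ := hCR
    obtain ⟨d, hd, hne⟩ := hE.exists_interior_inter_nonempty hdisj hopen hqC hq
    exact ⟨d, hd, hint d hd hne⟩
  · right
    have h1 : C ⊆ M.exterior r := fun q hq hq' => hCR ⟨q, hq, hq'⟩
    exact h1.antisymm (hsub isPreconnected_exterior
      (Set.compl_subset_compl.2 hE.squaring_subset) ⟨p, hpC, h1 hpC⟩)

theorem closure_exterior_subset :
    closure (M.exterior r) ⊆ (Set.Ioo 0 (M.totalCurrent r) ×ˢ Set.Ioo (0 : ℝ) 1)ᶜ :=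
  closure_minimal (Set.compl_subset_compl.2 (Set.prod_mono Set.Ioo_subset_Icc_self
    Set.Ioo_subset_Icc_self)) (isOpen_Ioo.prod isOpen_Ioo).isClosed_compl

/-! ### The embedding of the contacts graph -/

theorem Share.exists_walk {d d' : D} (h : M.Share d d') :
    ∃ p : M.derived.Walk (Sum.inr (Sum.inl (M.edge d))) (Sum.inr (Sum.inl (M.edge d'))),
      p.length ≤ 2 := by
  obtain ⟨a, b, ha, hb, h⟩ := h
  rw [← ha, ← hb]
  have htail : ∀ e, M.derived.Adj (Sum.inr (Sum.inl (M.edge e))) (Sum.inl (M.tail e)) :=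
    fun e => (SimpleGraph.fromRel_adj _ _ _).2 ⟨by simp, Or.inl ⟨e, rfl, Or.inl rfl⟩⟩
  have hface : ∀ e, M.derived.Adj (Sum.inr (Sum.inl (M.edge e)))
      (Sum.inr (Sum.inr (M.rightFace e))) :=
    fun e => (SimpleGraph.fromRel_adj _ _ _).2 ⟨by simp, Or.inl ⟨e, rfl, Or.inr rfl⟩⟩
  rcases h with h | h
  · exact ⟨.cons (htail a) (.cons (h ▸ (htail b).symm) .nil), le_rfl⟩
  · exact ⟨.cons (hface a) (.cons (h ▸ (hface b).symm) .nil), le_rfl⟩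

end CombMap

theorem mainTheorem9 {D : Type*} (M : CombMap D) (r : D)
    (hM : M.IsEdgeRootedPlanar r)
    (hrec : M.IsRecurrent) (hrec' : M.dual.IsRecurrent)
    (hdisj : M.SquaresDisjoint r)
    (hS : IsSquaringOfRectangle (M.squaring r))
    (hcross : M.NoDegenerateCross r) :
    contactsGraph (squaresOf (M.squaring r)) ⊑ graphSquare M.derived := by
  have hE := hM.isElectrical hrec hrec'
  -- a square of positive side is sent to its edge, the unbounded one to the root edge
  have hex : ∀ A : squaresOf (M.squaring r), ∃ d,
      (M.IsDown r d ∧ (A : Set (ℝ × ℝ)) = M.square r d) ∨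
      (d = r ∧ (A : Set (ℝ × ℝ)) = closure (M.exterior r)) := by
    rintro ⟨_, C, hC, rfl⟩
    rcases hE.eq_of_mem_complComponents hdisj hC with ⟨d, hd, rfl⟩ | rfl
    · exact ⟨d, Or.inl ⟨hd, hd.closure_interior hE⟩⟩
    · exact ⟨r, Or.inr ⟨rfl, rfl⟩⟩
  choose F hF using hex
  have hroot : ∀ {d}, M.IsDown r d → M.edge d ≠ M.edge r := fun hd h =>
    hd.1 (M.edge_eq_edge_iff.1 h.symm)
  have hinj : ∀ A B, M.edge (F A) = M.edge (F B) → A = B := by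
    intro A B h
    rcases hF A with ⟨hA, hA'⟩ | ⟨hA, hA'⟩ <;> rcases hF B with ⟨hB, hB'⟩ | ⟨hB, hB'⟩
    · exact Subtype.ext (by rw [hA', hB', hA.eq_of_edge_eq hB h])
    · exact absurd (hB ▸ h) (hroot hA)
    · exact absurd (hA ▸ h).symm (hroot hB)
    · exact Subtype.ext (by rw [hA', hB'])
  have hshare : ∀ A B : squaresOf (M.squaring r), A ≠ B →
      ((A : Set (ℝ × ℝ)) ∩ (B : Set (ℝ × ℝ))).Nonempty →
      M.Share (F A) (F B) := by
    rintro A B hne ⟨p, hpA, hpB⟩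
    rcases hF A with ⟨hA, hA'⟩ | ⟨hA, hA'⟩ <;> rcases hF B with ⟨hB, hB'⟩ | ⟨hB, hB'⟩ <;>
      rw [hA'] at hpA <;> rw [hB'] at hpB
    · rcases hE.eq_or_share_of_mem_square hdisj hcross hA hB hpA hpB with h | h
      · exact absurd (hinj A B (by rw [h])) hne
      · exact h
    · rw [hB]
      exact hE.share_root hA hpA (CombMap.closure_exterior_subset hpB)
    · rw [hA]
      exact (hE.share_root hB hpB (CombMap.closure_exterior_subset hpA)).symm
    · exact absurd (Subtype.ext (by rw [hA', hB'])) hne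
  have hinj' : Function.Injective fun A =>
      (Sum.inr (Sum.inl (M.edge (F A))) : M.Vertex ⊕ M.Edge ⊕ M.Face) :=
    fun A B h => hinj A B (Sum.inl_injective (Sum.inr_injective h))
  exact ⟨⟨⟨_, fun {A B} h => ⟨hinj'.ne h.1, (hshare A B h.1 h.2).exists_walk⟩⟩, hinj'⟩⟩
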